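/- Let $\mathfrak X$ be a countably infinite alphabet containing pairwise distinct letters $x$, $y_i$, $z_i$, $t_i$ ($i\ge 1$), and let $\mathfrak X^*$ be the free monoid over $\mathfrak X$, whose elements are called words. For $k\ge 2$ and a permutation $\pi$ of $\{1,\dots,k\}$ put $$\mathbf a_{0,k}[\pi]:=x\,\Bigl(\prod_{i=1}^{k-1} z_{\pi(i)}\,y_i^2\Bigr)\,z_{\pi(k)}\,x\,\Bigl(\prod_{i=1}^{k} t_i z_i\Bigr)\in\mathfrak X^*.$$ A letter is simple (multiple) in a word if it occurs in it exactly once (at least twice). Let $\lambda$ be the congruence on $\mathfrak X^*$ defined by: $\mathbf u\mathrel{\lambda}\mathbf v$ if and only if (1) $\mathbf u$ and $\mathbf v$ have the same simple letters; (2) $\mathbf u$ can be obtained from $\mathbf v$ by changing the individual (positive) exponents of letters; and (3) for each multiple letter, its first two occurrences are adjacent in $\mathbf u$ if and only if they are adjacent in $\mathbf v$. Let $[\mathbf w]^\lambda$ denote the $\lambda$-class of a word $\mathbf w$. For a set $W$ of $\lambda$-classes, let $M_\lambda(W)$ denote the Rees quotient of the monoid $\mathfrak X^*/\lambda$ by the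 ideal of all $\lambda$-classes that are not factors (in $\mathfrak X^*/\lambda$) of any member of $W$; write $M_\lambda(\mathtt w)$ for $M_\lambda(\{\mathtt w\})$, and let $\mathbf M_\lambda(\mathtt w)$ be the monoid variety generated by $M_\lambda(\mathtt w)$. **Proposition.** For every $k\ge 2$ and every permutation $\pi$ of $\{1,\dots,k\}$, the lattice of all subvarieties of the monoid variety $\mathbf M_\lambda\bigl([\mathbf a_{0,k}[\pi]]^\lambda\bigr)$ is not distributive. -/

import Mathlib

set_option linter.constructorNameAsVariable false
set_option linter.unusedVariables false

/-! ### Words -/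

/-- A countably infinite alphabet, with names for the letters that are used below. -/
inductive Letter : Type where
  | x : Letter
  | y : ℕ → Letter
  | z : ℕ → Letter
  | t : ℕ → Letter
  deriving DecidableEq

instance : Infinite Letter := Infinite.of_injective Letter.y (fun _ _ h => Letter.y.inj h)

instance : Countable Letter := by
  let f : Letter → ℕ × ℕ := fun a => match a with
    | .x => (0, 0)
    | .y i => (1, i)
    | .z i => (2, i)
    | .t i => (3, i)
  have hf : Function.Injective f := by
    intro a b h
    cases a <;> cases b <;> simp_all [f]
  exact hf.countable

/-- Words: elements of the free monoid over the alphabet. The empty word is `1`. -/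
abbrev Word : Type := FreeMonoid Letter

/-- The number of occurrences of a letter in a word. -/
def Word.occ (a : Letter) (w : Word) : ℕ := w.toList.count a

/-- The set of simple letters of a word: those that occur in it exactly once. -/
def Word.simple (w : Word) : Set Letter := {a | w.occ a = 1}

/-- The sequence of the letters that form the successive islands (maximal factors that are powers
of a single letter) of a word: for instance `x x y x x x` gives `x, y, x`. Two words have the same
sequence if and only if one is obtained from the other by changing the individual (positive)
exponents of letters. -/
def Word.islands (w : Word) : List Letter := w.toList.destutter (· ≠ ·)

/-- The letter `a` occurs at least twice in `w`, and its first two occurrences are adjacent. -/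
def Word.FirstTwoAdjacent (a : Letter) (w : Word) : Prop :=
  ∃ p q : List Letter, w.toList = p ++ a :: a :: q ∧ a ∉ p

/-- The relation `γ`. -/
def GammaRel (u v : Word) : Prop := u.simple = v.simple ∧ u.islands = v.islands

/-- The relation `λ`: the words are `γ`-related, and the first two occurrences of each multiple
letter are adjacent in both words or in neither. (`FirstTwoAdjacent` fails for a letter that is
not multiple, and `γ`-related words have the same multiple letters.) -/
def LambdaRel (u v : Word) : Prop :=
  GammaRel u v ∧ ∀ a : Letter, u.FirstTwoAdjacent a ↔ v.FirstTwoAdjacent a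

/-! ### `λ` is a congruence -/

section LambdaCongruence

variable {α : Type*} [DecidableEq α]

theorem head?_destutter'_ne (a : α) (l : List α) :
    (l.destutter' (· ≠ ·) a).head? = some a := by
  induction l with
  | nil => rfl
  | cons b l ih =>
    by_cases h : a = b
    · rw [List.destutter'_cons_neg (R := (· ≠ ·)) (h := by simpa using h)]; exact ih
    · rw [List.destutter'_cons_pos (R := (· ≠ ·)) (h := h)]; rfl

theorem destutter_cons_ne (a : α) (l : List α) :
    (a :: l).destutter (· ≠ ·) =
      if (l.destutter (· ≠ ·)).head? = some a then l.destutter (· ≠ ·)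
      else a :: l.destutter (· ≠ ·) := by
  cases l with
  | nil => simp
  | cons b l =>
    rw [List.destutter_cons', List.destutter_cons', head?_destutter'_ne]
    by_cases h : a = b
    · subst h
      rw [List.destutter'_cons_neg (R := (· ≠ ·)) (h := by simp)]; simp
    · rw [List.destutter'_cons_pos (R := (· ≠ ·)) (h := h), if_neg]
      simpa using fun h' => h h'.symm

theorem head?_destutter_ne (l : List α) : (l.destutter (· ≠ ·)).head? = l.head? := by
  cases l with
  | nil => rfl
  | cons b l => rw [List.destutter_cons', head?_destutter'_ne]; rfl

theorem getLast?_destutter_ne (l : List α) : (l.destutter (· ≠ ·)).getLast? = l.getLast? := by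
  induction l with
  | nil => rfl
  | cons a l ih =>
    rw [destutter_cons_ne]
    split_ifs with h
    · rw [ih]
      rw [head?_destutter_ne] at h
      cases l with
      | nil => simp at h
      | cons b l => simp [List.getLast?_cons]
    · simp only [List.getLast?_cons, ih]

theorem mem_destutter_ne (x : α) (l : List α) : x ∈ l.destutter (· ≠ ·) ↔ x ∈ l := by
  induction l with
  | nil => simp
  | cons a l ih =>
    rw [destutter_cons_ne]
    split_ifs with h
    · rw [ih, List.mem_cons]
      rw [head?_destutter_ne] at h
      have : a ∈ l := List.mem_of_mem_head? h
      constructor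
      · exact Or.inr
      · rintro (rfl | h') <;> assumption
    · rw [List.mem_cons, List.mem_cons, ih]

theorem destutter_concat_ne (l : List α) (a : α) :
    (l ++ [a]).destutter (· ≠ ·) =
      if (l.destutter (· ≠ ·)).getLast? = some a then l.destutter (· ≠ ·)
      else l.destutter (· ≠ ·) ++ [a] := by
  induction l with
  | nil => simp
  | cons b l ih =>
    rw [List.cons_append, destutter_cons_ne, destutter_cons_ne b l, head?_destutter_ne,
      head?_destutter_ne, ih]
    rw [getLast?_destutter_ne]
    cases l with
    | nil => by_cases h : a = b <;> simp [h, eq_comm]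
    | cons c l =>
      have h1 : (c :: l ++ [a]).head? = (c :: l).head? := by simp
      rw [h1]
      by_cases h2 : (c :: l).head? = some b
      · rw [if_pos h2, if_pos h2, getLast?_destutter_ne]
      · rw [if_neg h2, if_neg h2]
        simp only [List.getLast?_cons, getLast?_destutter_ne]
        by_cases h3 : l.getLast?.getD c = a <;> simp [h3]

end LambdaCongruence

theorem firstTwoAdjacent_cons (x a : Letter) (w : Word) :
    Word.FirstTwoAdjacent x (FreeMonoid.of a * w) ↔
      (a = x ∧ w.toList.head? = some x) ∨ (a ≠ x ∧ w.FirstTwoAdjacent x) := by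
  unfold Word.FirstTwoAdjacent
  rw [FreeMonoid.toList_mul, FreeMonoid.toList_of, List.singleton_append]
  constructor
  · rintro ⟨p, q, h, hp⟩
    cases p with
    | nil =>
      rw [List.nil_append, List.cons.injEq] at h
      exact Or.inl ⟨h.1, by rw [h.2]; rfl⟩
    | cons b p =>
      rw [List.cons_append, List.cons.injEq] at h
      rw [List.mem_cons, not_or] at hp
      exact Or.inr ⟨fun h' => hp.1 (h'.symm.trans h.1), p, q, h.2, hp.2⟩
  · rintro (⟨rfl, h⟩ | ⟨h, p, q, hw, hp⟩)
    · obtain ⟨q, hq⟩ := List.head?_eq_some_iff.1 h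
      exact ⟨[], q, by rw [hq]; rfl, by simp⟩
    · exact ⟨a :: p, q, by rw [hw]; rfl, by simp [hp, Ne.symm h]⟩

theorem firstTwoAdjacent_concat (x a : Letter) (w : Word) :
    Word.FirstTwoAdjacent x (w * FreeMonoid.of a) ↔
      w.FirstTwoAdjacent x ∨ (a = x ∧ w.occ x = 1 ∧ w.toList.getLast? = some x) := by
  induction w using FreeMonoid.inductionOn' with
  | one =>
    constructor
    · rintro ⟨p, q, h, hp⟩
      have := congrArg List.length h
      simp at this
      omega
    · rintro (⟨p, q, h, hp⟩ | ⟨_, h, _⟩)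
      · simp at h
      · simp [Word.occ] at h
  | of_mul b w ih =>
    rw [mul_assoc, firstTwoAdjacent_cons, firstTwoAdjacent_cons, ih]
    simp only [Word.occ, FreeMonoid.toList_mul, FreeMonoid.toList_of, List.singleton_append,
      List.getLast?_cons, List.count_cons]
    rcases hw : w.toList with _ | ⟨c, l⟩
    · by_cases hb : b = x <;> by_cases ha : a = x <;> simp [hb, ha]
    · by_cases hb : b = x
      · subst hb
        have : c = b → (List.count b (c :: l) + 1 = 1 ↔ False) := by
          rintro rfl; simp
        simp only [List.cons_append, List.head?_cons, true_and, ne_eq, not_true, false_and, or_false,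
          beq_self_eq_true, if_true, Option.some.injEq]
        constructor
        · exact Or.inl
        · rintro (h | ⟨_, h1, h2⟩)
          · exact h
          · exfalso
            have h3 : b ∉ c :: l := List.count_eq_zero.1 (by omega)
            apply h3
            apply List.mem_of_getLast?
            rw [List.getLast?_cons] at h2 ⊢
            simpa using h2
      · simp [hb, List.getLast?_cons]

theorem LambdaRel.of_mul {u v : Word} (h : LambdaRel u v) (a : Letter) :
    LambdaRel (FreeMonoid.of a * u) (FreeMonoid.of a * v) := by
  obtain ⟨⟨hs, hi⟩, hf⟩ := h
  have hmem : ∀ x, x ∈ u.toList ↔ x ∈ v.toList := fun x => by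
    rw [← mem_destutter_ne x u.toList, ← mem_destutter_ne x v.toList]
    exact iff_of_eq (congrArg (x ∈ ·) hi)
  have hhead : u.toList.head? = v.toList.head? := by
    rw [← head?_destutter_ne u.toList, ← head?_destutter_ne v.toList]
    exact congrArg List.head? hi
  refine ⟨⟨?_, ?_⟩, fun x => ?_⟩
  · ext x
    have h1 : u.occ x = 1 ↔ v.occ x = 1 := by
      have := congrArg (x ∈ ·) hs; simpa [Word.simple] using this
    have h0 : u.occ x = 0 ↔ v.occ x = 0 := by
      simp only [Word.occ, List.count_eq_zero, hmem]
    simp only [Word.simple, Word.occ, Set.mem_ofPred_eq, FreeMonoid.toList_mul, FreeMonoid.toList_of,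
      List.count_append] at *
    by_cases hx : a = x
    · simpa [hx] using h0
    · simpa [hx] using h1
  · have hi' : u.toList.destutter (· ≠ ·) = v.toList.destutter (· ≠ ·) := hi
    simp only [Word.islands, FreeMonoid.toList_mul, FreeMonoid.toList_of, List.singleton_append]
    rw [destutter_cons_ne, destutter_cons_ne, hi']
  · rw [firstTwoAdjacent_cons, firstTwoAdjacent_cons, hhead, hf x]

theorem LambdaRel.mul_of {u v : Word} (h : LambdaRel u v) (a : Letter) :
    LambdaRel (u * FreeMonoid.of a) (v * FreeMonoid.of a) := by
  obtain ⟨⟨hs, hi⟩, hf⟩ := h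
  have hmem : ∀ x, x ∈ u.toList ↔ x ∈ v.toList := fun x => by
    rw [← mem_destutter_ne x u.toList, ← mem_destutter_ne x v.toList]
    exact iff_of_eq (congrArg (x ∈ ·) hi)
  have hlast : u.toList.getLast? = v.toList.getLast? := by
    rw [← getLast?_destutter_ne u.toList, ← getLast?_destutter_ne v.toList]
    exact congrArg List.getLast? hi
  have h1 : ∀ x, u.occ x = 1 ↔ v.occ x = 1 := fun x => by
    have := congrArg (x ∈ ·) hs; simpa [Word.simple] using this
  refine ⟨⟨?_, ?_⟩, fun x => ?_⟩
  · ext x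
    have h1 := h1 x
    have h0 : u.occ x = 0 ↔ v.occ x = 0 := by
      simp only [Word.occ, List.count_eq_zero, hmem]
    simp only [Word.simple, Word.occ, Set.mem_ofPred_eq, FreeMonoid.toList_mul, FreeMonoid.toList_of,
      List.count_append] at *
    by_cases hx : a = x
    · simpa [hx] using h0
    · simpa [hx] using h1
  · have hi' : u.toList.destutter (· ≠ ·) = v.toList.destutter (· ≠ ·) := hi
    simp only [Word.islands, FreeMonoid.toList_mul, FreeMonoid.toList_of]
    rw [destutter_concat_ne, destutter_concat_ne, hi']
  · rw [firstTwoAdjacent_concat, firstTwoAdjacent_concat, hlast, hf x, h1 x]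

theorem LambdaRel.mul_left {u v : Word} (h : LambdaRel u v) (w : Word) :
    LambdaRel (w * u) (w * v) := by
  induction w using FreeMonoid.inductionOn' with
  | one => simpa using h
  | of_mul b w ih => rw [mul_assoc, mul_assoc]; exact ih.of_mul b

theorem LambdaRel.mul_right {u v : Word} (h : LambdaRel u v) (w : Word) :
    LambdaRel (u * w) (v * w) := by
  induction w using FreeMonoid.inductionOn' generalizing u v with
  | one => simpa using h
  | of_mul b w ih => rw [← mul_assoc, ← mul_assoc]; exact ih (h.mul_of b)

theorem LambdaRel.trans {u v w : Word} (h : LambdaRel u v) (h' : LambdaRel v w) :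
    LambdaRel u w :=
  ⟨⟨h.1.1.trans h'.1.1, h.1.2.trans h'.1.2⟩, fun a => (h.2 a).trans (h'.2 a)⟩

/-- The congruence `λ` on the free monoid. -/
def lambdaCon : Con Word where
  r := LambdaRel
  iseqv :=
    { refl := fun _ => ⟨⟨rfl, rfl⟩, fun _ => Iff.rfl⟩
      symm := fun h => ⟨⟨h.1.1.symm, h.1.2.symm⟩, fun a => (h.2 a).symm⟩
      trans := LambdaRel.trans }
  mul' := fun {_ b c _} h h' => (h.mul_right c).trans (h'.mul_left b)

/-! ### Monoid varieties -/

/-- The monoid `M` satisfies the identity `u ≈ v`. -/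
def SatisfiesIdentity (M : Type) [Monoid M] (u v : Word) : Prop :=
  ∀ φ : Letter → M, FreeMonoid.lift φ u = FreeMonoid.lift φ v

/-- The class of all monoids that satisfy all identities in the set `E`. -/
def modelsOf (E : Set (Word × Word)) : Set MonCat.{0} :=
  {M | ∀ e ∈ E, SatisfiesIdentity M e.1 e.2}

/-- A monoid variety: a class of monoids that is given by a set of identities. -/
structure MonoidVariety where
  carrier : Set MonCat.{0}
  exists_identities : ∃ E : Set (Word × Word), carrier = modelsOf E

namespace MonoidVariety

/-- Varieties are ordered by inclusion. -/
instance : PartialOrder MonoidVariety :=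
  PartialOrder.lift carrier (fun V W h => by cases V; cases W; cases h; rfl)

/-- The intersection of a family of varieties is a variety. -/
instance : InfSet MonoidVariety where
  sInf S :=
    { carrier := ⋂ V ∈ S, V.carrier
      exists_identities := by
        refine ⟨{e | ∃ V ∈ S, ∃ E, V.carrier = modelsOf E ∧ e ∈ E}, ?_⟩
        ext M
        simp only [Set.mem_iInter]
        constructor
        · rintro h e ⟨V, hV, E, hE, he⟩
          have := h V hV
          rw [hE] at this
          exact this e he
        · intro h V hV
          obtain ⟨E, hE⟩ := V.exists_identities
          rw [hE]
          exact fun e he => h e ⟨V, hV, E, hE, he⟩ }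

/-- The lattice of all monoid varieties: meet is intersection, and the join of a family is the
least variety that contains all its members. -/
instance : CompleteLattice MonoidVariety :=
  completeLatticeOfInf MonoidVariety (fun S =>
    ⟨fun V hV M hM => Set.mem_iInter₂.1 hM V hV,
      fun W hW M hM => Set.mem_iInter₂.2 fun V hV => hW hV hM⟩)

/-- The variety generated by a monoid: the least variety that contains it. -/
def generatedBy (M : Type) [Monoid M] : MonoidVariety :=
  sInf {V | MonCat.of M ∈ V.carrier}

/-- A variety is distributive if the lattice of its subvarieties is distributive. -/
def IsDistributive (V : MonoidVariety) : Prop :=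
  ∀ X Y Z : Set.Iic V, X ⊓ (Y ⊔ Z) = (X ⊓ Y) ⊔ (X ⊓ Z)

end MonoidVariety

/-! ### The monoids `M_α(W)` -/

/-- The Rees congruence of a two-sided ideal `I`: it collapses `I` to one element. -/
def reesCon {S : Type} [Monoid S] (I : Set S) (hl : ∀ a, ∀ b ∈ I, a * b ∈ I)
    (hr : ∀ a ∈ I, ∀ b, a * b ∈ I) : Con S where
  r a b := a = b ∨ (a ∈ I ∧ b ∈ I)
  iseqv :=
    { refl := fun _ => Or.inl rfl
      symm := fun h => h.elim (fun h => Or.inl h.symm) (fun h => Or.inr h.symm)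
      trans := by
        rintro a b c (rfl | h) (rfl | h')
        · exact Or.inl rfl
        · exact Or.inr h'
        · exact Or.inr h
        · exact Or.inr ⟨h.1, h'.2⟩ }
  mul' := by
    rintro a b c d (rfl | h) (rfl | h')
    · exact Or.inl rfl
    · exact Or.inr ⟨hl _ _ h'.1, hl _ _ h'.2⟩
    · exact Or.inr ⟨hr _ h.1 _, hr _ h.2 _⟩
    · exact Or.inr ⟨hr _ h.1 _, hr _ h.2 _⟩

/-- The closure of a set `W` of elements of a monoid under taking factors. -/
def factorClosure {S : Type} [Monoid S] (W : Set S) : Set S :=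
  {v | ∃ u ∈ W, ∃ p s : S, u = p * v * s}

/-- The Rees congruence on `S` of the ideal of all elements that are not factors of elements
of `W`. -/
def nonFactorCon {S : Type} [Monoid S] (W : Set S) : Con S :=
  reesCon (factorClosure W)ᶜ
    (by
      rintro a b hb ⟨u, hu, p, s, h⟩
      exact hb ⟨u, hu, p * a, s, by rw [h]; simp only [mul_assoc]⟩)
    (by
      rintro a ha b ⟨u, hu, p, s, h⟩
      exact ha ⟨u, hu, p, b * s, by rw [h]; simp only [mul_assoc]⟩)

/-- The monoid `M_α(W)`, for a congruence `α` on the free monoid and a set `W` of `α`-classes: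
the Rees quotient of the quotient monoid by the ideal of all `α`-classes that are not factors of
members of `W`. -/
abbrev SapirMonoid (α : Con Word) (W : Set α.Quotient) : Type :=
  (nonFactorCon W).Quotient

/-- The variety generated by `M_α(W)`. -/
def sapirVariety (α : Con Word) (W : Set α.Quotient) : MonoidVariety :=
  MonoidVariety.generatedBy (SapirMonoid α W)

/-! ### The words `a_{0,k}[π]` -/

/-- The word `x z_{π(1)} y_1² z_{π(2)} y_2² ⋯ y_{k-1}² z_{π(k)} x t_1 z_1 t_2 z_2 ⋯ t_k z_k`, where
the indices `1, …, k` are represented by the elements `0, …, k - 1` of `Fin k`. -/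
def aWord (k : ℕ) (π : Equiv.Perm (Fin k)) : Word :=
  FreeMonoid.of Letter.x
    * (List.ofFn fun i : Fin k =>
        FreeMonoid.of (Letter.z (π i))
          * (if (i : ℕ) + 1 < k then FreeMonoid.of (Letter.y i) ^ 2 else 1)).prod
    * FreeMonoid.of Letter.x
    * (List.ofFn fun i : Fin k => FreeMonoid.of (Letter.t i) * FreeMonoid.of (Letter.z i)).prod

open scoped List

/-! ### Lists and their islands -/

section ListIslands

variable {α : Type*} [DecidableEq α]

/-! Write k = K + 2, a = `wordA K σ`, x' = `y (K + 2)`, z' = `z (K + 2)`, z'' = `z (K + 3)`, V for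
the given variety, and D[s] for `doubledWord K σ s`. This word contains two overlapping copies of a:
x…x or x' …x' can serve as the outer letter, z_{π(1)} or z' as the first z, z_{π(k)} or z'' as the
last one. The factor s, one of 1, x, x', x'x, is inserted just before z_{π(k)}.

Let X be defined by D[1] ≈ D[x'], Y by D[1] ≈ D[x] and D[x'] ≈ D[x'x], and Z by D[x] ≈ D[x'x]. The
chain D[1] ≈ D[x] ≈ D[x'x] ≈ D[x'] gives Y ⊓ Z ≤ X. If the lattice were distributive, every N ≤ V
below Z and below (V ⊓ X) ⊔ (V ⊓ Y) would satisfy D[1] ≈ D[x'] (`IsDistributive.le`).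

A violating N is generated by the syntactic monoid of Q = Q₁ ∩ Q₂ ∩ Q₃. Such a monoid satisfies an
identity exactly when the set is stable under it (`satisfiesIdentity_syntacticCon`), and stability
passes to intersections. Preimages of λ-classes of factors of a under substitutions are stable under
all identities of M_λ(a) (`stableUnder_imageClass`), so sets built from them give members of V. Q₁
asks that two erasing projections with outer letter x give a, Q₂ asks the same for x', both with a
further condition on order (`mark`), and Q₃ forces x not to occur after z''. The word D[1] is in Q,
but D[x'] is not in Q₂, having two letters x' before z_{π(k)} (`not_inSecond`). It remains to see
that Q₁ ∩ Q₃ is stable under the identity of X, Q₂ ∩ Q₃ under those of Y, and Q under that of Z.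

All stability proofs rest on the rigidity of a (`repeated_cases`): a nonempty factor repeated with
no t in between either forms a power of one letter together with what lies between, or it is x at
the two islands of x. Hence deleting a middle occurrence never changes the λ-class, and inserting
one can do so only if the outer letter is sent to the two islands ("main" case). In that case
letters z are counted: the inner letters z recur in the ending, so their images are powers of one
letter and yield at most one z each, while the squared y's yield none. Since k letters z are needed,
the z's at the ends must supply theirs. If this happened in both projections of Q₁ (or of Q₂), the
image of a letter that occurs twice would contain both versions of the first (or last) z, contrary
to the order of occurrences (`notMem_of_occurs_twice`). For Q and D[x] ≈ D[x'x] the contradiction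
comes from counting the letters x before and after z_{π(k)} (`not_rightMain_and_rightMain`). -/

theorem destutter_cons_of_head?_eq {a : α} {l : List α} (h : l.head? = some a) :
    (a :: l).destutter (· ≠ ·) = l.destutter (· ≠ ·) := by
  rw [destutter_cons_ne, head?_destutter_ne, if_pos h]

theorem destutter_cons_of_head?_ne {a : α} {l : List α} (h : l.head? ≠ some a) :
    (a :: l).destutter (· ≠ ·) = a :: l.destutter (· ≠ ·) := by
  rw [destutter_cons_ne, head?_destutter_ne, if_neg h]

theorem isChain_of_isChain_destutter {R : α → α → Prop} (hR : ∀ a, R a a) {l : List α}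
    (h : (l.destutter (· ≠ ·)).IsChain R) : l.IsChain R := by
  induction l with
  | nil => simp
  | cons a l ih =>
    by_cases ha : l.head? = some a
    · rw [destutter_cons_of_head?_eq ha] at h
      rw [List.isChain_cons]
      refine ⟨fun y hy => ?_, ih h⟩
      rw [ha] at hy
      obtain rfl : a = y := by simpa using hy
      exact hR _
    · rw [destutter_cons_of_head?_ne ha, List.isChain_cons, head?_destutter_ne] at h
      exact List.isChain_cons.2 ⟨h.1, ih h.2⟩

/-- Neighbouring distinct letters of `s` come from different islands, so each can be replaced by the
representative of its island. -/
theorem sublist_destutter {s l : List α} (hs : s <+ l) (hc : s.IsChain (· ≠ ·)) :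
    s <+ l.destutter (· ≠ ·) := by
  induction l generalizing s with
  | nil => simpa using hs
  | cons a l ih =>
    rcases List.sublist_cons_iff.1 hs with h | ⟨s', rfl, h⟩
    · by_cases ha : l.head? = some a
      · rw [destutter_cons_of_head?_eq ha]; exact ih h hc
      · rw [destutter_cons_of_head?_ne ha]; exact (ih h hc).cons _
    · have h' := ih h (List.isChain_cons.1 hc).2
      by_cases ha : l.head? = some a
      · rw [destutter_cons_of_head?_eq ha]
        rw [← head?_destutter_ne] at ha
        obtain ⟨d, hd⟩ := List.head?_eq_some_iff.1 ha
        rw [hd] at h' ⊢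
        rcases List.sublist_cons_iff.1 h' with h2 | ⟨s'', rfl, h2⟩
        · exact h2.cons_cons _
        · exact absurd rfl ((List.isChain_cons.1 hc).1 a (by simp))
      · rw [destutter_cons_of_head?_ne ha]; exact h'.cons_cons _

/-- A cut of the island sequence falls between two islands, so it lifts to a cut of the list. -/
theorem exists_append_of_destutter_eq_append {l A C : List α}
    (h : l.destutter (· ≠ ·) = A ++ C) :
    ∃ l₁ l₂, l = l₁ ++ l₂ ∧ l₁.destutter (· ≠ ·) = A ∧ l₂.destutter (· ≠ ·) = C := by
  induction l generalizing A with
  | nil =>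
    obtain ⟨rfl, rfl⟩ : A = [] ∧ C = [] := by simpa using h.symm
    exact ⟨[], [], by simp⟩
  | cons a l ih =>
    rcases A with _ | ⟨b, A⟩
    · exact ⟨[], a :: l, by simpa using h⟩
    by_cases ha : l.head? = some a
    · rw [destutter_cons_of_head?_eq ha] at h
      obtain ⟨l₁, l₂, rfl, h1, h2⟩ := ih h
      have hb : some a = some b := by
        rw [← ha, ← head?_destutter_ne, h]; rfl
      refine ⟨a :: l₁, l₂, rfl, ?_, h2⟩
      rw [destutter_cons_of_head?_eq, h1]
      rw [← head?_destutter_ne, h1, hb]; rfl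
    · rw [destutter_cons_of_head?_ne ha, List.cons_append, List.cons.injEq] at h
      obtain ⟨rfl, h⟩ := h
      obtain ⟨l₁, l₂, rfl, h1, h2⟩ := ih h
      refine ⟨a :: l₁, l₂, rfl, ?_, h2⟩
      rw [destutter_cons_of_head?_ne, h1]
      intro h3
      apply ha
      cases l₁ with
      | nil => simp at h3
      | cons b l => simpa using h3

theorem eq_replicate_of_destutter_eq_singleton {l : List α} {a : α}
    (h : l.destutter (· ≠ ·) = [a]) : ∃ n, l = List.replicate (n + 1) a := by
  cases l with
  | nil => simp at h
  | cons b l =>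
    refine ⟨l.length, List.eq_replicate_iff.2 ⟨by simp, fun c hc => ?_⟩⟩
    rw [← mem_destutter_ne, h] at hc
    simpa using hc

/-- If all islands of a list belong to different letters, then the occurrences of every letter
are consecutive. -/
theorem eq_of_mem_between {l p m q : List α} {c : α} (hl : (l.destutter (· ≠ ·)).Nodup)
    (h : l = p ++ c :: m ++ c :: q) : ∀ e ∈ m, e = c := by
  intro e he
  by_contra hne
  -- Otherwise c, e, c would survive in the island sequence, which repeats no letter.
  have h1 : [c, e, c] <+ l := by
    rw [h]
    have : [c, e, c] <+ (c :: m) ++ c :: q := by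
      have : [c, e] ++ [c] <+ (c :: m) ++ c :: q :=
        ((List.singleton_sublist.2 he).cons_cons c).append (by simp)
      simpa using this
    rw [List.append_assoc]
    exact this.trans (List.sublist_append_right _ _)
  have h2 := sublist_destutter h1 (by simp [hne, Ne.symm hne])
  have := hl.sublist h2
  simp at this

/-- Each occurrence of `a` contributes a full copy of its image. This is how a letter that is rare
in the image restricts the substitution. -/
theorem mul_count_le_count_flatMap {β : Type*} [DecidableEq β] (l : List α) (f : α → List β)
    (a : α) (b : β) : l.count a * (f a).count b ≤ (l.flatMap f).count b := by
  induction l with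
  | nil => simp
  | cons c l ih =>
    rw [List.flatMap_cons, List.count_append, List.count_cons]
    by_cases h : c = a
    · subst h; simp only [beq_self_eq_true, if_true]; linarith
    · simp only [beq_iff_eq, h, if_false, add_zero]; omega

end ListIslands

theorem append_cons_inj {α : Type*} {p p' q q' : List α} {a : α} (hp : a ∉ p) (hp' : a ∉ p')
    (h : p ++ a :: q = p' ++ a :: q') : p = p' ∧ q = q' := by
  induction p generalizing p' with
  | nil =>
    rcases p' with _ | ⟨b, p'⟩
    · simpa using h
    · simp only [List.nil_append, List.cons_append, List.cons.injEq] at h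
      exact absurd (by simp [h.1]) hp'
  | cons c p ih =>
    rcases p' with _ | ⟨b, p'⟩
    · simp only [List.nil_append, List.cons_append, List.cons.injEq] at h
      exact absurd (by simp [h.1]) hp
    · simp only [List.cons_append, List.cons.injEq, List.mem_cons, not_or] at h hp hp'
      obtain ⟨rfl, rfl⟩ := ih hp.2 hp'.2 h.2
      exact ⟨by rw [h.1], rfl⟩

theorem infix_flatMap_of_mem {α β : Type*} {l : List α} {a : α} (h : a ∈ l) (f : α → List β) :
    f a <:+: l.flatMap f := by
  obtain ⟨s, t, rfl⟩ := List.append_of_mem h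
  exact ⟨s.flatMap f, t.flatMap f, by simp⟩

theorem countP_flatMap_le {α β : Type*} {l : List α} {f : α → List β} {P : α → Bool} {Q : β → Bool}
    (h : ∀ a ∈ l, (f a).countP Q ≤ if P a then 1 else 0) :
    (l.flatMap f).countP Q ≤ l.countP P := by
  induction l with
  | nil => simp
  | cons c l ih =>
    rw [List.flatMap_cons, List.countP_append, List.countP_cons]
    have h1 := h c (by simp)
    have h2 := ih fun a ha => h a (by simp [ha])
    omega

/-- If adjacent letters outside `S` coincide, then a factor outside `S` is a power of a letter. -/
theorem eq_of_isChain {α : Type*} {S : α → Prop} {l : List α}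
    (h : l.IsChain fun a b => a = b ∨ S a ∨ S b) (hS : ∀ a ∈ l, ¬ S a) :
    ∀ a ∈ l, ∀ b ∈ l, a = b := by
  have h1 : l.IsChain (· = ·) := by
    induction l with
    | nil => simp
    | cons a l ih =>
      rw [List.isChain_cons] at h ⊢
      refine ⟨fun b hb => ?_, ih h.2 fun c hc => hS c (by simp [hc])⟩
      rcases h.1 b hb with h | h | h
      · exact h
      · exact absurd h (hS a (by simp))
      · exact absurd h (hS b (by simp [List.mem_of_mem_head? hb]))
  have h2 : l.Pairwise (· = ·) := List.isChain_iff_pairwise.1 h1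
  exact fun a ha b hb => h2.forall_of_forall (fun _ _ => rfl) ha hb

/-! ### `λ` on lists of letters -/

/-- The congruence `λ`, on lists of letters. -/
def LambdaList (u v : List Letter) : Prop :=
  LambdaRel (FreeMonoid.ofList u) (FreeMonoid.ofList v)

namespace LambdaList

theorem refl (u : List Letter) : LambdaList u u := lambdaCon.refl _

theorem symm {u v : List Letter} (h : LambdaList u v) : LambdaList v u := lambdaCon.symm h

theorem trans {u v w : List Letter} (h : LambdaList u v) (h' : LambdaList v w) :
    LambdaList u w := lambdaCon.trans h h'

theorem append {u v u' v' : List Letter} (h : LambdaList u v) (h' : LambdaList u' v') :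
    LambdaList (u ++ u') (v ++ v') := lambdaCon.mul h h'

theorem destutter_eq {u v : List Letter} (h : LambdaList u v) :
    u.destutter (· ≠ ·) = v.destutter (· ≠ ·) := h.1.2

theorem mem_iff {u v : List Letter} (h : LambdaList u v) (a : Letter) : a ∈ u ↔ a ∈ v := by
  rw [← mem_destutter_ne, h.destutter_eq, mem_destutter_ne]

theorem count_le_one {u v : List Letter} (h : LambdaList u v) {a : Letter}
    (ha : v.count a ≤ 1) : u.count a ≤ 1 := by
  by_cases h0 : a ∈ v
  · have h1 : v.count a = 1 := le_antisymm ha (List.count_pos_iff.2 h0)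
    have h2 : a ∈ Word.simple (FreeMonoid.ofList v) := h1
    rw [← h.1.1] at h2
    exact le_of_eq h2
  · rw [← h.mem_iff a] at h0
    simp [List.count_eq_zero.2 h0]

theorem sublist {u v s : List Letter} (h : LambdaList u v) (hs : s <+ u)
    (hc : s.IsChain (· ≠ ·)) : s <+ v :=
  (sublist_destutter hs hc).trans (h.destutter_eq ▸ List.destutter_sublist _ _)

/-- A letter that occurred before can be doubled. -/
theorem double {P : List Letter} {d : Letter} (hd : d ∈ P) :
    LambdaList (P ++ [d]) (P ++ [d, d]) := by
  have e : P ++ [d, d] = (P ++ [d]) ++ [d] := by simp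
  have hc : 1 ≤ P.count d := List.count_pos_iff.2 hd
  refine ⟨⟨?_, ?_⟩, fun a => ?_⟩
  · ext a
    simp only [Word.simple, Word.occ, Set.mem_ofPred_eq, FreeMonoid.toList_ofList,
      List.count_append]
    by_cases h : d = a
    · subst h; simp; omega
    · simp [h]
  · simp only [Word.islands, FreeMonoid.toList_ofList]
    rw [e, destutter_concat_ne (P ++ [d]), if_pos]
    rw [getLast?_destutter_ne]; simp
  · have h1 : FreeMonoid.ofList (P ++ [d, d]) =
        FreeMonoid.ofList (P ++ [d]) * FreeMonoid.of d := by rw [e]; rfl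
    rw [h1, firstTwoAdjacent_concat]
    constructor
    · exact Or.inl
    · rintro (h | ⟨rfl, h, -⟩)
      · exact h
      · simp [Word.occ] at h; omega

/-- Since `d` already occurs in `P`, the length of a later run of `d` affects neither simplicity nor
the adjacency of the first two occurrences. -/
theorem run {P s s' : List Letter} {d : Letter} (hd : d ∈ P) (hs : s ≠ []) (hs' : s' ≠ [])
    (h : ∀ e ∈ s, e = d) (h' : ∀ e ∈ s', e = d) (Q : List Letter) :
    LambdaList (P ++ s ++ Q) (P ++ s' ++ Q) := by
  have key : ∀ n, LambdaList (P ++ [d]) (P ++ List.replicate (n + 1) d) := by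
    intro n
    induction n with
    | zero => exact refl _
    | succ n ih =>
      have h1 := (double hd).append (refl (List.replicate n d))
      have e1 : P ++ [d] ++ List.replicate n d = P ++ List.replicate (n + 1) d := by
        simp [List.replicate_succ]
      have e2 : P ++ [d, d] ++ List.replicate n d = P ++ List.replicate (n + 1 + 1) d := by
        simp [List.replicate_succ]
      rw [e1, e2] at h1
      exact ih.trans h1
  have key2 : ∀ t : List Letter, t ≠ [] → (∀ e ∈ t, e = d) → LambdaList (P ++ [d]) (P ++ t) := by
    intro t ht he
    have := List.eq_replicate_of_mem he
    obtain ⟨n, hn⟩ := Nat.exists_eq_succ_of_ne_zero (mt List.length_eq_zero_iff.1 ht)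
    rw [this, hn]
    exact key n
  exact ((key2 s hs h).symm.trans (key2 s' hs' h')).append (refl Q)

end LambdaList

/-! ### Varieties and syntactic monoids -/

theorem lift_lift (φ : Letter → Word) {M : Type} [Monoid M] (ψ : Letter → M) (u : Word) :
    FreeMonoid.lift ψ (FreeMonoid.lift φ u) =
      FreeMonoid.lift (fun a => FreeMonoid.lift ψ (φ a)) u := by
  induction u using FreeMonoid.inductionOn' with
  | one => simp
  | of_mul b w ih => simp [ih]

theorem toList_lift (φ : Letter → Word) (u : Word) :
    (FreeMonoid.lift φ u).toList = u.toList.flatMap fun a => (φ a).toList := by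
  induction u using FreeMonoid.inductionOn' with
  | one => simp
  | of_mul b w ih => simp [ih]

namespace MonoidVariety

/-- The variety of all monoids that satisfy all identities in the set `E`. -/
def ofIdentities (E : Set (Word × Word)) : MonoidVariety := ⟨modelsOf E, E, rfl⟩

theorem generatedBy_le_iff {M : Type} [Monoid M] {V : MonoidVariety} :
    generatedBy M ≤ V ↔ MonCat.of M ∈ V.carrier := by
  constructor
  · intro h
    have : MonCat.of M ∈ (generatedBy M).carrier := Set.mem_iInter₂.2 fun W hW => hW
    exact h this
  · exact fun h => sInf_le h

theorem generatedBy_le_ofIdentities {M : Type} [Monoid M] {E : Set (Word × Word)} :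
    generatedBy M ≤ ofIdentities E ↔ ∀ e ∈ E, SatisfiesIdentity M e.1 e.2 :=
  generatedBy_le_iff

/-- This handles joins: an identity of a join holds in both joinands, and nothing else about the
join is needed. -/
theorem le_of_forall_identities {N : Type} [Monoid N] {V : MonoidVariety}
    (h : ∀ u v : Word, V ≤ ofIdentities {(u, v)} → SatisfiesIdentity N u v) :
    generatedBy N ≤ V := by
  rw [generatedBy_le_iff]
  obtain ⟨E, hE⟩ := V.exists_identities
  rw [hE]
  intro e he
  refine h e.1 e.2 fun M hM => ?_
  rw [hE] at hM
  rintro _ rfl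
  exact hM e he

/-- If the lattice of subvarieties is distributive, then an identity that holds in `X` and in
`Y ⊓ Z` holds in `(X ⊔ Y) ⊓ (X ⊔ Z)`. -/
theorem IsDistributive.le {V : MonoidVariety} (hV : V.IsDistributive) {X Y Z N W : MonoidVariety}
    (hN : N ≤ V) (hXY : N ≤ (V ⊓ X) ⊔ (V ⊓ Y)) (hZ : N ≤ Z) (hX : X ≤ W) (hYZ : Y ⊓ Z ≤ W) :
    N ≤ W := by
  have hX' : V ⊓ X ≤ V := inf_le_left
  have hY' : V ⊓ Y ≤ V := inf_le_left
  have h := hV ⟨N, hN⟩ ⟨V ⊓ X, hX'⟩ ⟨V ⊓ Y, hY'⟩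
  have h1 : (⟨N, hN⟩ : Set.Iic V) ⊓ ((⟨V ⊓ X, hX'⟩ : Set.Iic V) ⊔ ⟨V ⊓ Y, hY'⟩) = ⟨N, hN⟩ :=
    inf_eq_left.2 hXY
  rw [h1] at h
  have h2 : N = (N ⊓ (V ⊓ X)) ⊔ (N ⊓ (V ⊓ Y)) := congrArg Subtype.val h
  rw [h2]
  -- The first summand lies below X, the second below Y ⊓ Z because N ≤ Z.
  refine sup_le (inf_le_right.trans (inf_le_right.trans hX)) (le_trans ?_ hYZ)
  exact le_inf (inf_le_right.trans inf_le_right) (inf_le_left.trans hZ)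

end MonoidVariety

/-- The syntactic congruence of a set of words. -/
def syntacticCon (Q : Set Word) : Con Word where
  r u v := ∀ p q : Word, p * u * q ∈ Q ↔ p * v * q ∈ Q
  iseqv :=
    { refl := fun _ _ _ => Iff.rfl
      symm := fun h p q => (h p q).symm
      trans := fun h h' p q => (h p q).trans (h' p q) }
  mul' := fun {a b c d} h h' p q => by
    have h1 := h p (c * q)
    have h2 := h' (p * b) q
    simp only [← mul_assoc] at h1 h2 ⊢
    exact h1.trans h2

/-- A set of words is stable under an identity if it is closed under replacing a substitution
instance of one of its sides by the same instance of the other one. -/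
def StableUnder (Q : Set Word) (u v : Word) : Prop :=
  ∀ (φ : Letter → Word) (p q : Word),
    p * FreeMonoid.lift φ u * q ∈ Q ↔ p * FreeMonoid.lift φ v * q ∈ Q

/-- Every substitution into the syntactic monoid lifts, letter by letter, to a substitution into
words. -/
theorem satisfiesIdentity_syntacticCon {Q : Set Word} {u v : Word} :
    SatisfiesIdentity (syntacticCon Q).Quotient u v ↔ StableUnder Q u v := by
  have key : ∀ (φ : Letter → Word) (w : Word),
      FreeMonoid.lift (fun a => ((φ a : Word) : (syntacticCon Q).Quotient)) w =
        ((FreeMonoid.lift φ w : Word) : (syntacticCon Q).Quotient) := by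
    intro φ w
    induction w using FreeMonoid.inductionOn' with
    | one => simp
    | of_mul b w ih => simp [ih]
  constructor
  · intro h φ
    have := h fun a => ((φ a : Word) : (syntacticCon Q).Quotient)
    rw [key, key] at this
    exact (Con.eq _).1 this
  · intro h φ
    choose ψ hψ using fun a => Con.mk'_surjective (c := syntacticCon Q) (φ a)
    obtain rfl : (fun a => ((ψ a : Word) : (syntacticCon Q).Quotient)) = φ := funext hψ
    rw [key, key]
    exact (Con.eq _).2 (h ψ)

theorem StableUnder.inter {Q R : Set Word} {u v : Word} (hQ : StableUnder Q u v)
    (hR : StableUnder R u v) : StableUnder (Q ∩ R) u v :=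
  fun φ p q => and_congr (hQ φ p q) (hR φ p q)

/-- The set of all words whose image under a substitution belongs to the `λ`-class of `f`. -/
def imageClass (h : Letter → Word) (f : Word) : Set Word :=
  {u | LambdaRel (FreeMonoid.lift h u) f}

/-- An instance of `u` inside a word of the λ-class of `f` represents a factor of the class of `w`,
so it is nonzero in the Rees quotient. Equality there with the instance of `v` is then
λ-equivalence. -/
theorem stableUnder_imageClass {w f f₁ f₂ : Word} (hf : w = f₁ * f * f₂) (h : Letter → Word)
    {u v : Word}
    (huv : SatisfiesIdentity (SapirMonoid lambdaCon {((w : Word) : lambdaCon.Quotient)}) u v) :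
    StableUnder (imageClass h f) u v := by
  have key : ∀ (φ : Letter → Word) (a b : Word),
      SatisfiesIdentity (SapirMonoid lambdaCon {((w : Word) : lambdaCon.Quotient)}) a b →
      ∀ p q : Word, LambdaRel (p * FreeMonoid.lift φ a * q) f →
        LambdaRel (p * FreeMonoid.lift φ b * q) f := by
    intro φ a b hab p q hp
    have h1 := hab fun l => (((φ l : Word) : lambdaCon.Quotient) :
      (nonFactorCon {((w : Word) : lambdaCon.Quotient)}).Quotient)
    have h2 : ∀ c : Word, FreeMonoid.lift (fun l => (((φ l : Word) : lambdaCon.Quotient) :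
        (nonFactorCon {((w : Word) : lambdaCon.Quotient)}).Quotient)) c =
        (((FreeMonoid.lift φ c : Word) : lambdaCon.Quotient) :
        (nonFactorCon {((w : Word) : lambdaCon.Quotient)}).Quotient) := by
      intro c
      induction c using FreeMonoid.inductionOn' with
      | one => simp
      | of_mul b w ih => simp [ih]
    rw [h2, h2] at h1
    rcases (Con.eq _).1 h1 with h3 | ⟨h3, -⟩
    · have h4 : LambdaRel (FreeMonoid.lift φ a) (FreeMonoid.lift φ b) := (Con.eq _).1 h3
      exact ((h4.mul_left p).mul_right q |> lambdaCon.symm).trans hp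
    -- Collapse to zero is impossible: multiplying by f₁p and qf₂ gives the class of `w`.
    · refine absurd ?_ h3
      refine ⟨_, rfl, ((f₁ * p : Word) : lambdaCon.Quotient),
        ((q * f₂ : Word) : lambdaCon.Quotient), ?_⟩
      rw [hf, ← Con.coe_mul, ← Con.coe_mul, Con.eq]
      have h4 : LambdaRel (f₁ * (p * FreeMonoid.lift φ a * q) * f₂) (f₁ * f * f₂) :=
        (hp.mul_left f₁).mul_right f₂
      simp only [mul_assoc] at h4 ⊢
      exact lambdaCon.symm h4
  intro φ p q
  have hvu : SatisfiesIdentity (SapirMonoid lambdaCon {((w : Word) : lambdaCon.Quotient)}) v u :=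
    fun φ => (huv φ).symm
  simp only [imageClass, Set.mem_ofPred_eq, map_mul, lift_lift]
  exact ⟨key _ u v huv _ _, key _ v u hvu _ _⟩

/-! ### The words `a_{0,k}[π]` as lists -/

namespace Letter

def isY : Letter → Bool
  | y _ => true
  | _ => false

def isZ : Letter → Bool
  | z _ => true
  | _ => false

def isT : Letter → Bool
  | t _ => true
  | _ => false

end Letter

open Letter

/-- The part of the word `a_{0,k}[π]`, with `k = K + 2`, between its first two letters `z`; the
letters `y` have exponent `n`. -/
def midPart (n K : ℕ) (σ : Equiv.Perm ℕ) : List Letter :=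
  List.replicate n (y 0) ++
    (List.range K).flatMap fun i => z (σ (i + 1)) :: List.replicate n (y (i + 1))

/-- The part of the word `a_{0,k}[π]`, with `k = K + 2`, between the two letters `x`; the letters
`y` have exponent `n`. -/
def body (n K : ℕ) (σ : Equiv.Perm ℕ) : List Letter :=
  z (σ 0) :: (midPart n K σ ++ [z (σ (K + 1))])

/-- The part of the word `a_{0,k}[π]`, with `k = K + 2`, after the last `x`. -/
def ending (K : ℕ) : List Letter :=
  (List.range (K + 2)).flatMap fun i => [t i, z i]

/-- The word `a_{0,k}[π]`, with `k = K + 2`, where `σ` extends `π` to all natural numbers. -/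
def wordA (K : ℕ) (σ : Equiv.Perm ℕ) : List Letter :=
  x :: (body 2 K σ ++ x :: ending K)

/-! ### Letters and islands of a. -/

section Basic

variable {K : ℕ} {σ : Equiv.Perm ℕ} {n : ℕ}

theorem x_notMem_body : x ∉ body n K σ := by simp [body, midPart]

theorem t_notMem_body (i : ℕ) : t i ∉ body n K σ := by simp [body, midPart]

theorem y_notMem_ending (i : ℕ) : y i ∉ ending K := by simp [ending]

theorem x_notMem_ending : x ∉ ending K := by simp [ending]

theorem nodup_body : (body 1 K σ).Nodup := by
  have h : ((List.range K).flatMap fun i => [z (σ (i + 1)), y (i + 1)]).Nodup := by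
    rw [List.nodup_flatMap]
    refine ⟨by simp, List.nodup_range.imp ?_⟩
    intro a b hab
    simp [Function.onFun, List.Disjoint, hab]
  simp only [body, midPart, List.replicate_one, List.cons_append, List.nil_append,
    List.nodup_cons, List.nodup_append, h]
  refine ⟨by simp, by simp, trivial, by simp, ?_⟩
  intro a ha b hb
  obtain ⟨i, hi, h⟩ := List.mem_flatMap.1 ha
  obtain rfl := List.mem_singleton.1 hb
  rintro rfl
  simp at h hi
  omega

theorem nodup_ending : (ending K).Nodup := by
  rw [ending, List.nodup_flatMap]
  refine ⟨by simp, (List.nodup_range).imp ?_⟩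
  intro a b hab
  simp [Function.onFun, List.Disjoint, hab]

theorem mem_body_iff {a : Letter} (hn : n ≠ 0) : a ∈ body n K σ ↔ a ∈ body 1 K σ := by
  simp [body, midPart, hn]

theorem count_z_body (i : ℕ) : (body n K σ).count (z i) ≤ 1 := by
  have : (body n K σ).count (z i) = (body 1 K σ).count (z i) := by
    simp [body, midPart, List.count_flatMap, List.count_cons, List.count_replicate,
      Function.comp_def]
  rw [this]
  exact List.nodup_iff_count_le_one.1 nodup_body _

theorem countP_isZ_body : (body n K σ).countP isZ = K + 2 := by
  simp [body, midPart, List.countP_cons, List.countP_append, List.countP_flatMap, isZ,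
    List.countP_replicate, Function.comp_def]

theorem y_zero_mem_body : y 0 ∈ body 1 K σ := by simp [body, midPart]

/-- Together with `eq_of_isChain`, this makes every factor of the body without letters y a power of
one letter. The letters t play the same role in the ending. -/
theorem isChain_body : (body 1 K σ).IsChain fun a b => a = b ∨ a.isY ∨ b.isY := by
  have h : ∀ (l : List ℕ) (c : ℕ), (y c :: (l.flatMap (fun i => [z (σ (i + 1)), y (i + 1)]) ++
      [z (σ (K + 1))])).IsChain fun a b => a = b ∨ a.isY ∨ b.isY := by
    intro l
    induction l with
    | nil => simp [isY]
    | cons a l ih => intro c; simpa [isY] using ih (a + 1)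
  simpa [body, midPart, isY] using h (List.range K) 0

theorem isChain_ending :
    (x :: ending K).IsChain fun a b => a = b ∨ a.isT ∨ b.isT := by
  have h : ∀ (l : List ℕ) (c : Letter), (c :: l.flatMap fun i => [t i, z i]).IsChain
      fun a b => a = b ∨ a.isT ∨ b.isT := by
    intro l
    induction l with
    | nil => simp
    | cons a l ih => intro c; simpa [isT] using ih (z a)
  exact h _ _

theorem pairwise_ending (i : ℕ) : (ending K).Pairwise fun a b => ¬ (a = z i ∧ b = t i) := by
  rw [ending, List.pairwise_flatMap]
  refine ⟨by simp, (List.nodup_range).imp ?_⟩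
  intro a b hab
  simp
  intro h h'
  exact hab (h.trans h'.symm)

theorem head?_ending : (ending K).head? = some (t 0) := by
  simp [ending, List.range_succ_eq_map]

theorem destutter_wordA :
    (wordA K σ).destutter (· ≠ ·) = x :: (body 1 K σ ++ x :: ending K) := by
  have h1 : (x :: ending K).destutter (· ≠ ·) = x :: ending K := by
    refine List.destutter_of_isChain _ _ (List.Pairwise.isChain ?_)
    exact List.nodup_cons.2 ⟨x_notMem_ending, nodup_ending⟩
  have key : ∀ (l : List ℕ) (c : ℕ) (s : List Letter), (∀ i, s.head? ≠ some (y i)) →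
      (y c :: y c :: (l.flatMap (fun i => [z (σ (i + 1)), y (i + 1), y (i + 1)]) ++ s)).destutter
        (· ≠ ·) =
      y c :: (l.flatMap (fun i => [z (σ (i + 1)), y (i + 1)]) ++ s.destutter (· ≠ ·)) := by
    intro l
    induction l with
    | nil =>
      intro c s hs
      rw [destutter_cons_of_head?_eq (by rfl), destutter_cons_of_head?_ne]
      · rfl
      · simpa using hs c
    | cons a l ih =>
      intro c s hs
      simp only [List.flatMap_cons, List.cons_append, List.nil_append]
      rw [destutter_cons_of_head?_eq (by rfl), destutter_cons_of_head?_ne (by simp),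
        destutter_cons_of_head?_ne (by simp), ih _ _ hs]
  have h2 := key (List.range K) 0 (z (σ (K + 1)) :: x :: ending K) (by simp)
  rw [destutter_cons_of_head?_ne (a := z (σ (K + 1))) (by simp), h1] at h2
  have h3 : wordA K σ = x :: z (σ 0) :: y 0 :: y 0 ::
      ((List.range K).flatMap (fun i => [z (σ (i + 1)), y (i + 1), y (i + 1)]) ++
        z (σ (K + 1)) :: x :: ending K) := by
    simp [wordA, body, midPart, List.replicate_succ]
  rw [h3, destutter_cons_of_head?_ne (by simp), destutter_cons_of_head?_ne (by simp), h2]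
  simp [body, midPart]

theorem not_firstTwoAdjacent_x : ¬ Word.FirstTwoAdjacent x (FreeMonoid.ofList (wordA K σ)) := by
  rintro ⟨p, q, h, hp⟩
  rw [FreeMonoid.toList_ofList, wordA, body] at h
  rcases p with _ | ⟨b, p⟩
  · simp at h
  · simp only [List.cons_append, List.cons.injEq] at h
    exact hp (by simp [h.1])

theorem not_firstTwoAdjacent_z {i : ℕ} (hi : z i ∈ body 2 K σ) :
    ¬ Word.FirstTwoAdjacent (z i) (FreeMonoid.ofList (wordA K σ)) := by
  rintro ⟨p, q, h, hp⟩
  rw [FreeMonoid.toList_ofList, wordA] at h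
  obtain ⟨B₁, B₂, hB, hB₁⟩ := List.eq_append_cons_of_mem hi
  have hc := count_z_body (n := 2) (K := K) (σ := σ) i
  rw [hB, List.count_append, List.count_cons_self] at hc
  have hB₂ : z i ∉ B₂ := fun h => by
    have := List.count_pos_iff.2 h
    omega
  rw [hB] at h
  have h' : (x :: B₁) ++ z i :: (B₂ ++ x :: ending K) = p ++ z i :: z i :: q := by
    simpa using h
  have h2 := (append_cons_inj (by simpa using hB₁) hp h').2
  rcases B₂ with _ | ⟨b, B₂⟩
  · simp at h2
  · simp only [List.cons_append, List.cons.injEq] at h2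
    exact hB₂ (by simp [h2.1])

end Basic

/-- The words between the two islands `x` of a word from the `λ`-class of `a_{0,k}[π]`. -/
structure IsBody (K : ℕ) (σ : Equiv.Perm ℕ) (B : List Letter) : Prop where
  destutter_eq : B.destutter (· ≠ ·) = body 1 K σ
  count_z_le (i : ℕ) : B.count (z i) ≤ 1

/-- The words after the two islands `x` of a word from the `λ`-class of `a_{0,k}[π]`. -/
def IsEnding (K : ℕ) (T : List Letter) : Prop := T.destutter (· ≠ ·) = ending K

/-- The island sequence gives the block structure. The exponent 1 of the first x and of the letters
z in the body comes from clause (3) of λ: each of them recurs in a, but not adjacently. -/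
theorem LambdaList.exists_of_wordA {K : ℕ} {σ : Equiv.Perm ℕ} {u : List Letter}
    (h : LambdaList u (wordA K σ)) :
    ∃ B n T, u = x :: (B ++ List.replicate (n + 1) x ++ T) ∧ IsBody K σ B ∧ IsEnding K T := by
  have h1 : u.destutter (· ≠ ·) = [x] ++ (body 1 K σ ++ ([x] ++ ending K)) := by
    rw [h.destutter_eq, destutter_wordA]; rfl
  obtain ⟨u₁, u', rfl, h₁, h2⟩ := exists_append_of_destutter_eq_append h1
  obtain ⟨B, u'', rfl, hB, h3⟩ := exists_append_of_destutter_eq_append h2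
  obtain ⟨u₃, T, rfl, h₃, hT⟩ := exists_append_of_destutter_eq_append h3
  obtain ⟨m, rfl⟩ := eq_replicate_of_destutter_eq_singleton h₁
  obtain ⟨n, rfl⟩ := eq_replicate_of_destutter_eq_singleton h₃
  obtain rfl : m = 0 := by
    by_contra hm
    obtain ⟨m, rfl⟩ := Nat.exists_eq_succ_of_ne_zero hm
    refine not_firstTwoAdjacent_x ((h.2 x).1 ⟨[], List.replicate m x ++
      (B ++ (List.replicate (n + 1) x ++ T)), ?_, by simp⟩)
    simp [List.replicate_succ]
  refine ⟨B, n, T, by simp, ⟨hB, fun i => ?_⟩, hT⟩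
  by_contra hc
  have hmem : z i ∈ B := List.count_pos_iff.1 (by omega)
  obtain ⟨p, q, rfl, hp⟩ := List.eq_append_cons_of_mem hmem
  have hq : z i ∈ q := by
    rw [List.count_append, List.count_cons_self, List.count_eq_zero.2 hp] at hc
    exact List.count_pos_iff.1 (by omega)
  obtain ⟨m, q', rfl, -⟩ := List.eq_append_cons_of_mem hq
  -- Two occurrences of `z i` in B would share an island, so the first two occurrences would be
  -- adjacent.
  have hm := eq_of_mem_between (hB ▸ nodup_body) (by simp : p ++ z i :: (m ++ z i :: q') =
    p ++ z i :: m ++ z i :: q')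
  have hq' : ∃ r, m ++ z i :: q' = z i :: r := by
    rcases m with _ | ⟨b, m⟩
    · exact ⟨_, rfl⟩
    · exact ⟨m ++ z i :: q', by rw [hm b (by simp)]; rfl⟩
  obtain ⟨r, hr⟩ := hq'
  rw [hr] at h hB
  refine not_firstTwoAdjacent_z (i := i) ?_ ((h.2 (z i)).1 ⟨x :: p,
    r ++ (List.replicate (n + 1) x ++ T), by simp, by simpa using hp⟩)
  rw [mem_body_iff two_ne_zero, ← hB, mem_destutter_ne]
  simp

/-! ### Repeated factors of the words in the `λ`-class of `a_{0,k}[π]` -/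

section Repeated

variable {K : ℕ} {σ : Equiv.Perm ℕ} {B T : List Letter}

theorem IsBody.mem_iff (hB : IsBody K σ B) (a : Letter) : a ∈ B ↔ a ∈ body 1 K σ := by
  rw [← hB.destutter_eq, mem_destutter_ne]

theorem IsBody.x_notMem (hB : IsBody K σ B) : x ∉ B := by
  rw [hB.mem_iff]; exact x_notMem_body

theorem IsBody.y_zero_mem (hB : IsBody K σ B) : y 0 ∈ B := by
  rw [hB.mem_iff]; exact y_zero_mem_body

theorem IsBody.isChain (hB : IsBody K σ B) : B.IsChain fun a b => a = b ∨ a.isY ∨ b.isY :=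
  isChain_of_isChain_destutter (by simp) (hB.destutter_eq ▸ isChain_body)

theorem IsBody.le_countP (hB : IsBody K σ B) : K + 2 ≤ B.countP isZ := by
  rw [← countP_isZ_body (n := 1) (K := K) (σ := σ), ← hB.destutter_eq]
  exact (List.destutter_sublist _ _).countP_le

theorem IsBody.head? (hB : IsBody K σ B) : B.head? = some (z (σ 0)) := by
  rw [← head?_destutter_ne, hB.destutter_eq]; rfl

theorem IsBody.getLast? (hB : IsBody K σ B) : B.getLast? = some (z (σ (K + 1))) := by
  rw [← getLast?_destutter_ne, hB.destutter_eq]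
  exact List.getLast?_concat (l := z (σ 0) :: midPart 1 K σ)

theorem IsEnding.mem_iff (hT : IsEnding K T) (a : Letter) : a ∈ T ↔ a ∈ ending K := by
  rw [← mem_destutter_ne, hT]

theorem IsEnding.head? (hT : IsEnding K T) : T.head? = some (t 0) := by
  rw [← head?_destutter_ne, hT, head?_ending]

theorem IsEnding.isChain (hT : IsEnding K T) (n : ℕ) :
    (List.replicate n x ++ T).IsChain fun a b => a = b ∨ a.isT ∨ b.isT := by
  rw [List.isChain_append]
  refine ⟨List.isChain_replicate_of_rel _ (Or.inl rfl), ?_, ?_⟩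
  · refine isChain_of_isChain_destutter (by simp) ?_
    have := isChain_ending (K := K)
    rw [hT]
    exact (List.isChain_cons.1 this).2
  · intro a _ b hb
    rw [hT.head?] at hb
    obtain rfl : t 0 = b := by simpa using hb
    simp [isT]

theorem IsEnding.eq_of_infix (hT : IsEnding K T) {n : ℕ} {w : List Letter}
    (hw : w <:+: List.replicate n x ++ T) (ht : ∀ i, t i ∉ w) : ∀ a ∈ w, ∀ b ∈ w, a = b := by
  refine eq_of_isChain ((hT.isChain n).infix hw) fun a ha h => ?_
  cases a with
  | t i => exact ht i ha
  | _ => simp [isT] at h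

theorem IsEnding.y_notMem (hT : IsEnding K T) {n : ℕ} {w : List Letter}
    (hw : w <:+: List.replicate n x ++ T) (i : ℕ) : y i ∉ w := by
  intro h
  have h1 := hw.subset h
  rw [List.mem_append, hT.mem_iff, List.mem_replicate] at h1
  rcases h1 with h1 | h1
  · simp at h1
  · exact y_notMem_ending i h1

theorem IsBody.eq_replicate_of_eq_append (hB : IsBody K σ B) {r s : List Letter} {e : ℕ}
    (h : r ++ x :: s = B ++ List.replicate e x) : ∃ e', r = B ++ List.replicate e' x ∧
      ∀ a ∈ s, a = x := by
  rcases List.append_eq_append_iff.1 h with ⟨as, h1, h2⟩ | ⟨bs, h1, h2⟩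
  · rcases as with _ | ⟨a, as⟩
    · refine ⟨0, by simpa using h1.symm, fun a ha => ?_⟩
      have : a ∈ List.replicate e x := by
        rw [List.nil_append] at h2
        rw [← h2]; simp [ha]
      exact List.eq_of_mem_replicate this
    · simp only [List.cons_append, List.cons.injEq] at h2
      exact absurd (by simp [h1, h2.1]) hB.x_notMem
  · obtain ⟨-, h3, h4⟩ := List.append_eq_replicate_iff.1 h2.symm
    refine ⟨_, by rw [h1, ← h3], fun a ha => ?_⟩
    have : a ∈ x :: s := by simp [ha]
    rw [h4] at this
    exact List.eq_of_mem_replicate this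

theorem isBody_append_replicate_nodup (hB : IsBody K σ B) (n : ℕ) :
    ((B ++ List.replicate (n + 1) x).destutter (· ≠ ·)).Nodup := by
  have h : (B ++ List.replicate (n + 1) x).destutter (· ≠ ·) = body 1 K σ ++ [x] := by
    induction n with
    | zero =>
      rw [List.replicate_one, destutter_concat_ne, getLast?_destutter_ne, hB.getLast?,
        if_neg (by simp), hB.destutter_eq]
    | succ n ih =>
      rw [List.replicate_succ', ← List.append_assoc, destutter_concat_ne, if_pos, ih]
      rw [ih]; simp
  rw [h]
  simp only [List.nodup_append, nodup_body, List.nodup_singleton, true_and, List.mem_singleton]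
  rintro a ha _ rfl rfl
  exact x_notMem_body ha

/-- In a word from the `λ`-class of `a_{0,k}[π]`, two occurrences of a letter without a letter `t`
between them belong to the same island, or they are the two islands of `x`. -/
theorem eq_of_mem_between_or (hB : IsBody K σ B) (hT : IsEnding K T) {n : ℕ} {p m q : List Letter}
    {d : Letter} (h : x :: (B ++ List.replicate (n + 1) x ++ T) = p ++ (d :: m ++ d :: q))
    (ht : ∀ i, t i ∉ d :: m) :
    (∀ e ∈ m, e = d) ∨ (d = x ∧ p = [] ∧
      ∃ e n', m = B ++ List.replicate e x ∧ q = List.replicate n' x ++ T) := by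
  have h' : (x :: (B ++ List.replicate (n + 1) x)) ++ T = p ++ (d :: m ++ d :: q) := by
    simpa using h
  rcases List.append_eq_append_iff.1 h' with ⟨as, rfl, h2⟩ | ⟨bs, h1, h2⟩
  · left
    have hw : d :: m ++ [d] <:+: List.replicate 0 x ++ T := ⟨as, q, by simp [h2]⟩
    have := hT.eq_of_infix hw (fun i hi => ht i (by simpa [or_comm, or_assoc] using hi))
    exact fun e he => this e (by simp [he]) d (by simp)
  -- T begins with t₀, so a factor that starts before T and has no t cannot reach into T.
  · obtain ⟨T', hT'⟩ := List.head?_eq_some_iff.1 hT.head?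
    have hbs : ∃ q', bs = d :: m ++ d :: q' ∧ q = q' ++ T := by
      have h3 : (d :: m ++ [d]) ++ q = bs ++ T := by simpa using h2
      rcases List.append_eq_append_iff.1 h3 with ⟨as, h4, h5⟩ | ⟨cs, h4, h5⟩
      · exact ⟨as, by simp [h4], h5⟩
      · rcases cs with _ | ⟨c, cs⟩
        · exact ⟨[], by simpa using h4.symm, by simpa using h5.symm⟩
        · rw [hT', List.cons_append, List.cons.injEq] at h5
          have : t 0 ∈ d :: m ++ [d] := by rw [h4]; simp [h5.1]
          exact absurd (by simpa [or_comm, or_assoc] using this) (ht 0)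
    obtain ⟨q', rfl, rfl⟩ := hbs
    rcases p with _ | ⟨c, p⟩
    · simp only [List.nil_append, List.cons_append, List.cons.injEq] at h1
      obtain ⟨rfl, h1⟩ := h1
      obtain ⟨e, h3, h4⟩ := hB.eq_replicate_of_eq_append h1.symm
      exact Or.inr ⟨rfl, rfl, e, q'.length, h3, by rw [← List.eq_replicate_of_mem h4]⟩
    · simp only [List.cons_append, List.cons.injEq] at h1
      left
      refine eq_of_mem_between (p := p) (q := q') (isBody_append_replicate_nodup hB n) ?_
      rw [h1.2]; simp

/-- Two occurrences of a factor `v` without a letter `t` between them: either everything is a power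
of a single letter, or the factor is `x`, and the occurrences are the two islands of `x`. -/
theorem repeated_cases {f₁ f₂ P v r s Q : List Letter}
    (h : LambdaList (f₁ ++ (P ++ v ++ r ++ s ++ v ++ Q) ++ f₂) (wordA K σ)) (hv : v ≠ [])
    (ht : ∀ i, t i ∉ v ∧ t i ∉ r ∧ t i ∉ s) :
    (∃ d, ∀ e ∈ v ++ r ++ s, e = d) ∨ (f₁ = [] ∧ P = [] ∧ v = [x] ∧ ∃ B T e n',
      IsBody K σ B ∧ IsEnding K T ∧ r ++ s = B ++ List.replicate e x ∧
      Q ++ f₂ = List.replicate n' x ++ T) := by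
  obtain ⟨B, n, T, hu, hB, hT⟩ := h.exists_of_wordA
  -- Compare the last letters of the two copies of v: the gap between them consists of r, s and the
  -- rest of v.
  obtain ⟨α, d, rfl⟩ := (List.eq_nil_or_concat v).resolve_left hv
  simp only [List.concat_eq_append] at *
  have h1 : x :: (B ++ List.replicate (n + 1) x ++ T) =
      (f₁ ++ P ++ α) ++ (d :: (r ++ s ++ α) ++ d :: (Q ++ f₂)) := by
    rw [← hu]; simp
  have ht' : ∀ i, t i ∉ d :: (r ++ s ++ α) := by
    intro i
    have := ht i
    simp only [List.mem_append, List.mem_singleton, not_or] at this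
    simp [this]
  rcases eq_of_mem_between_or hB hT h1 ht' with h2 | ⟨rfl, h2, e, n', h3, h4⟩
  · left
    refine ⟨d, fun e he => ?_⟩
    simp only [List.mem_append, List.mem_singleton] at he h2
    rcases he with ((he | he) | he) | he
    · exact h2 e (Or.inr he)
    · exact he
    · exact h2 e (Or.inl (Or.inl he))
    · exact h2 e (Or.inl (Or.inr he))
  · simp only [List.append_eq_nil_iff] at h2
    obtain ⟨⟨rfl, rfl⟩, rfl⟩ := h2
    right
    exact ⟨rfl, rfl, rfl, B, T, e, n', hB, hT, by simpa using h3, h4⟩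

theorem lambdaList_insert_of_eq {P v r s Q : List Letter} {d : Letter} (hv : v ≠ [])
    (h : ∀ e ∈ v ++ r ++ s, e = d) :
    LambdaList (P ++ v ++ r ++ s ++ v ++ Q) (P ++ v ++ r ++ v ++ s ++ v ++ Q) := by
  have hd : d ∈ P ++ v := by
    obtain ⟨a, ha⟩ := List.exists_mem_of_ne_nil v hv
    rw [← h a (by simp [ha])]
    simp [ha]
  have := LambdaList.run hd (s := r ++ s ++ v) (s' := r ++ v ++ s ++ v) (by simp [hv])
    (by simp [hv]) (fun e he => h e (by simp at he ⊢; tauto))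
    (fun e he => h e (by simp at he ⊢; tauto)) Q
  simpa using this

theorem lambdaList_insert_of_eq_x {P r s Q : List Letter} (h : ∀ e ∈ s, e = x) :
    LambdaList (P ++ [x] ++ r ++ s ++ [x] ++ Q) (P ++ [x] ++ r ++ [x] ++ s ++ [x] ++ Q) := by
  have := LambdaList.run (P := P ++ [x] ++ r) (d := x) (by simp) (s := s ++ [x])
    (s' := [x] ++ s ++ [x]) (by simp) (by simp) (fun e he => by simp at he; aesop)
    (fun e he => by simp at he; aesop) Q
  simpa using this

/-- In the nontrivial case the outer copies of v are the two islands of x. Since B has no x, the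
middle copy already belongs to the last island, and so does s. -/
theorem lambdaList_delete {f₁ f₂ P v r s Q : List Letter}
    (h : LambdaList (f₁ ++ (P ++ v ++ r ++ v ++ s ++ v ++ Q) ++ f₂) (wordA K σ))
    (ht : ∀ i, t i ∉ v ∧ t i ∉ r ∧ t i ∉ s) :
    LambdaList (P ++ v ++ r ++ v ++ s ++ v ++ Q) (P ++ v ++ r ++ s ++ v ++ Q) := by
  by_cases hv : v = []
  · subst hv; simp [LambdaList.refl]
  have h' : LambdaList (f₁ ++ (P ++ v ++ r ++ (v ++ s) ++ v ++ Q) ++ f₂) (wordA K σ) := by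
    simpa using h
  rcases repeated_cases h' hv (fun i => by simp [ht i]) with
    ⟨d, hd⟩ | ⟨-, -, rfl, B, T, e, n', hB, hT, h1, h2⟩
  · refine (lambdaList_insert_of_eq hv (d := d) fun e he => hd e ?_).symm
    simp at he ⊢; tauto
  · obtain ⟨-, -, h3⟩ := hB.eq_replicate_of_eq_append (by simpa using h1)
    exact (lambdaList_insert_of_eq_x h3).symm

end Repeated

/-! ### Insertion of a letter into an identity -/

section Insertion

variable {K : ℕ} {σ : Equiv.Perm ℕ}

theorem count_t_wordA_le (i : ℕ) : (wordA K σ).count (t i) ≤ 1 := by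
  have h1 : (body 2 K σ).count (t i) = 0 := List.count_eq_zero.2 (t_notMem_body i)
  have h2 : (ending K).count (t i) ≤ 1 := List.nodup_iff_count_le_one.1 nodup_ending _
  simp [wordA, h1, h2]

/-- A substitution maps the identity that inserts the letter `X` between `R` and `S` in
`A X R S X C` in such a way that the two occurrences of `X` are the two islands of `x` in a word
from the `λ`-class of `a_{0,k}[π]`. -/
structure IsMain (K : ℕ) (σ : Equiv.Perm ℕ) (g : Letter → List Letter)
    (A R S C P Q : List Letter) (X : Letter) : Prop where
  left_eq : P ++ A.flatMap g = []
  apply_eq : g X = [x]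
  exists_body : ∃ B T e n, IsBody K σ B ∧ IsEnding K T ∧
    R.flatMap g ++ S.flatMap g = B ++ List.replicate e x ∧
    C.flatMap g ++ Q = List.replicate n x ++ T

variable {A R S C : List Letter} {X : Letter} {f₁ f f₂ p q : List Letter}
  {φ h : Letter → List Letter}

/-- The letters t are simple in a, so they cannot come from a letter that is substituted twice. -/
theorem t_notMem_of_count (hf : wordA K σ = f₁ ++ f ++ f₂) {U : List Letter}
    (hu : LambdaList ((p ++ U.flatMap φ ++ q).flatMap h) f) {l : Letter} (hl : 2 ≤ U.count l)
    (i : ℕ) : t i ∉ (φ l).flatMap h := by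
  intro hi
  have h1 : f.count (t i) ≤ 1 := by
    have := count_t_wordA_le (K := K) (σ := σ) i
    rw [hf, List.count_append, List.count_append] at this
    omega
  have h2 := hu.count_le_one h1
  have h3 := mul_count_le_count_flatMap U (fun l => (φ l).flatMap h) l (t i)
  have h4 := List.count_pos_iff.2 hi
  rw [List.flatMap_append, List.flatMap_append, List.flatMap_assoc, List.count_append,
    List.count_append] at h2
  have h5 : 2 * 1 ≤ U.count l * ((φ l).flatMap h).count (t i) := Nat.mul_le_mul hl h4
  omega

theorem t_notMem_flatMap_of_count (hf : wordA K σ = f₁ ++ f ++ f₂) {U V : List Letter}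
    (hu : LambdaList ((p ++ U.flatMap φ ++ q).flatMap h) f) (hl : ∀ l ∈ V, 2 ≤ U.count l)
    (i : ℕ) : t i ∉ V.flatMap fun l => (φ l).flatMap h := by
  rw [List.mem_flatMap]
  rintro ⟨l, hV, hi⟩
  exact t_notMem_of_count hf hu (hl l hV) i hi

theorem flatMap_pattern :
    (p ++ (A ++ [X] ++ R ++ S ++ [X] ++ C).flatMap φ ++ q).flatMap h =
      (p.flatMap h ++ A.flatMap fun l => (φ l).flatMap h) ++ (φ X).flatMap h ++
        (R.flatMap fun l => (φ l).flatMap h) ++ (S.flatMap fun l => (φ l).flatMap h) ++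
        (φ X).flatMap h ++ ((C.flatMap fun l => (φ l).flatMap h) ++ q.flatMap h) := by
  simp [List.flatMap_assoc]

theorem flatMap_pattern' :
    (p ++ (A ++ [X] ++ R ++ [X] ++ S ++ [X] ++ C).flatMap φ ++ q).flatMap h =
      (p.flatMap h ++ A.flatMap fun l => (φ l).flatMap h) ++ (φ X).flatMap h ++
        (R.flatMap fun l => (φ l).flatMap h) ++ (φ X).flatMap h ++
        (S.flatMap fun l => (φ l).flatMap h) ++
        (φ X).flatMap h ++ ((C.flatMap fun l => (φ l).flatMap h) ++ q.flatMap h) := by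
  simp [List.flatMap_assoc]

/-- The main case forces `f₁ = []`, because the first island of x opens a. It therefore never arises
for a factor taken from after the first x. -/
theorem pattern_cases (hf : wordA K σ = f₁ ++ f ++ f₂)
    (hc : ∀ l ∈ X :: (R ++ S), 2 ≤ (A ++ [X] ++ R ++ S ++ [X] ++ C).count l)
    (hu : LambdaList ((p ++ (A ++ [X] ++ R ++ S ++ [X] ++ C).flatMap φ ++ q).flatMap h) f) :
    ((φ X).flatMap h = [] ∨ ∃ d, ∀ e ∈ (φ X).flatMap h ++
      (R.flatMap fun l => (φ l).flatMap h) ++ (S.flatMap fun l => (φ l).flatMap h), e = d) ∨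
    (f₁ = [] ∧ IsMain K σ (fun l => (φ l).flatMap h) A R S C (p.flatMap h)
      (q.flatMap h ++ f₂) X) := by
  by_cases hX : (φ X).flatMap h = []
  · exact Or.inl (Or.inl hX)
  have ht : ∀ i, t i ∉ (φ X).flatMap h ∧ (t i ∉ R.flatMap fun l => (φ l).flatMap h) ∧
      t i ∉ S.flatMap fun l => (φ l).flatMap h := fun i =>
    ⟨t_notMem_of_count hf hu (hc X (by simp)) i,
      t_notMem_flatMap_of_count hf hu (fun l hl => hc l (by simp [hl])) i,
      t_notMem_flatMap_of_count hf hu (fun l hl => hc l (by simp [hl])) i⟩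
  have h1 : LambdaList (f₁ ++ (p ++ (A ++ [X] ++ R ++ S ++ [X] ++ C).flatMap φ ++ q).flatMap h ++
      f₂) (wordA K σ) := by
    rw [hf]; exact ((LambdaList.refl _).append hu).append (LambdaList.refl _)
  rw [flatMap_pattern] at h1
  rcases repeated_cases h1 hX ht with h2 | ⟨h2, h3, h4, B, T, e, n, hB, hT, h5, h6⟩
  · exact Or.inl (Or.inr h2)
  · exact Or.inr ⟨h2, h3, h4, B, T, e, n, hB, hT, h5, by simpa using h6⟩

theorem pattern_insert_of_eq
    (hX : (φ X).flatMap h = [] ∨ ∃ d, ∀ e ∈ (φ X).flatMap h ++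
      (R.flatMap fun l => (φ l).flatMap h) ++ (S.flatMap fun l => (φ l).flatMap h), e = d)
    (hu : LambdaList ((p ++ (A ++ [X] ++ R ++ S ++ [X] ++ C).flatMap φ ++ q).flatMap h) f) :
    LambdaList ((p ++ (A ++ [X] ++ R ++ [X] ++ S ++ [X] ++ C).flatMap φ ++ q).flatMap h) f := by
  refine LambdaList.trans ?_ hu
  rw [flatMap_pattern, flatMap_pattern']
  by_cases h0 : (φ X).flatMap h = []
  · rw [h0]; simp [LambdaList.refl]
  · obtain ⟨d, hd⟩ := hX.resolve_left h0
    exact (lambdaList_insert_of_eq h0 hd).symm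

theorem pattern_insert_of_eq_x (hX : (φ X).flatMap h = [x])
    (hS : ∀ e ∈ S.flatMap fun l => (φ l).flatMap h, e = x)
    (hu : LambdaList ((p ++ (A ++ [X] ++ R ++ S ++ [X] ++ C).flatMap φ ++ q).flatMap h) f) :
    LambdaList ((p ++ (A ++ [X] ++ R ++ [X] ++ S ++ [X] ++ C).flatMap φ ++ q).flatMap h) f := by
  refine LambdaList.trans ?_ hu
  rw [flatMap_pattern, flatMap_pattern', hX]
  exact (lambdaList_insert_of_eq_x hS).symm

theorem pattern_delete (hf : wordA K σ = f₁ ++ f ++ f₂)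
    (hc : ∀ l ∈ X :: (R ++ S), 2 ≤ (A ++ [X] ++ R ++ [X] ++ S ++ [X] ++ C).count l)
    (hu : LambdaList ((p ++ (A ++ [X] ++ R ++ [X] ++ S ++ [X] ++ C).flatMap φ ++ q).flatMap h) f) :
    LambdaList ((p ++ (A ++ [X] ++ R ++ S ++ [X] ++ C).flatMap φ ++ q).flatMap h) f := by
  have ht : ∀ i, t i ∉ (φ X).flatMap h ∧ (t i ∉ R.flatMap fun l => (φ l).flatMap h) ∧
      t i ∉ S.flatMap fun l => (φ l).flatMap h := fun i =>
    ⟨t_notMem_of_count hf hu (hc X (by simp)) i,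
      t_notMem_flatMap_of_count hf hu (fun l hl => hc l (by simp [hl])) i,
      t_notMem_flatMap_of_count hf hu (fun l hl => hc l (by simp [hl])) i⟩
  have h1 : LambdaList (f₁ ++ (p ++ (A ++ [X] ++ R ++ [X] ++ S ++ [X] ++ C).flatMap φ ++
      q).flatMap h ++ f₂) (wordA K σ) := by
    rw [hf]; exact ((LambdaList.refl _).append hu).append (LambdaList.refl _)
  rw [flatMap_pattern'] at h1
  refine LambdaList.trans ?_ hu
  rw [flatMap_pattern, flatMap_pattern']
  exact (lambdaList_delete h1 ht).symm

end Insertion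

/-! ### The identities -/

/-- The block that follows the second letter `x'`. -/
def innerPart (K : ℕ) (σ : Equiv.Perm ℕ) : List Letter := z (K + 2) :: midPart 2 K σ

/-- The word `t₁ z₁ ⋯ t_k z_k`, where the letters `z_{π(1)}` and `z_{π(k)}` are doubled. -/
def doubledEnding (K : ℕ) (σ : Equiv.Perm ℕ) : List Letter :=
  (List.range (K + 2)).flatMap fun i => [t i, z i] ++
    ((if i = σ 0 then [t (K + 2), z (K + 2)] else []) ++
    (if i = σ (K + 1) then [t (K + 3), z (K + 3)] else []))

/-- The word `a_{0,k}[π]`, with a second letter `x' = y_k`, with the letters `z_{π(1)}` and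
`z_{π(k)}` doubled, and with an additional factor `s`. -/
def doubledWord (K : ℕ) (σ : Equiv.Perm ℕ) (s : List Letter) : List Letter :=
  x :: z (σ 0) :: y (K + 2) :: (innerPart K σ ++ (s ++ z (σ (K + 1)) :: x :: z (K + 3) ::
    y (K + 2) :: doubledEnding K σ))

/-! ### Counting letters z in the main case. -/

section Main

variable {K : ℕ} {σ : Equiv.Perm ℕ} {B T : List Letter}

theorem countP_isZ_le_one_of_eq {w : List Letter} (hw : ∀ a ∈ w, ∀ b ∈ w, a = b)
    (hc : ∀ i, w.count (z i) ≤ 1) : w.countP isZ ≤ 1 := by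
  by_cases h : ∃ i, z i ∈ w
  · obtain ⟨i, hi⟩ := h
    have h1 := List.eq_replicate_of_mem (a := z i) fun b hb => hw b hb _ hi
    have h2 := hc i
    rw [h1, List.count_replicate_self] at h2
    exact List.countP_le_length.trans h2
  · have : w.countP isZ = 0 := by
      rw [List.countP_eq_zero]
      intro a ha haz
      cases a with
      | z i => exact h ⟨i, ha⟩
      | _ => simp [isZ] at haz
    omega

theorem IsBody.count_append_le (hB : IsBody K σ B) (e i : ℕ) :
    (B ++ List.replicate e x).count (z i) ≤ 1 := by
  simpa [List.count_replicate] using hB.count_z_le i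

theorem countP_isZ_replicate_x (e : ℕ) : (List.replicate e x).countP isZ = 0 := by
  simp [List.countP_replicate, isZ]

theorem countP_isZ_midPart : (midPart 2 K σ).countP isZ = K := by
  simp [midPart, List.countP_cons, List.countP_flatMap, isZ, Function.comp_def]

theorem IsBody.eq_of_infix (hB : IsBody K σ B) {w : List Letter} (hw : w <:+: B)
    (hy : ∀ i, y i ∉ w) : ∀ a ∈ w, ∀ b ∈ w, a = b := by
  refine eq_of_isChain (hB.isChain.infix hw) fun a ha h => ?_
  cases a with
  | y i => exact hy i ha
  | _ => simp [isY] at h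

/-- A suffix without letters `y` of a word `B x ⋯ x`, if it contains a letter `z`. -/
theorem IsBody.of_suffix (hB : IsBody K σ B) {r s : List Letter} {e : ℕ}
    (h : r ++ s = B ++ List.replicate e x) (hy : ∀ i, y i ∉ s) (hs : 1 ≤ s.countP isZ) :
    z (σ (K + 1)) ∈ s ∧ s.countP isZ ≤ 1 ∧ y 0 ∈ r ∧ r.head? = some (z (σ 0)) := by
  rcases List.append_eq_append_iff.1 h with ⟨s₁, h1, h2⟩ | ⟨bs, h1, h2⟩
  · have h3 : s₁.countP isZ = s.countP isZ := by
      rw [h2, List.countP_append, countP_isZ_replicate_x, add_zero]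
    have hy1 : ∀ i, y i ∉ s₁ := fun i hi => hy i (by simp [h2, hi])
    have h4 := hB.eq_of_infix (w := s₁) ⟨r, [], by simp [h1]⟩ hy1
    have h5 : s₁ ≠ [] := by rintro rfl; simp at h3; omega
    have h6 : z (σ (K + 1)) ∈ s₁ := by
      apply List.mem_of_getLast?
      rw [← hB.getLast?, h1, List.getLast?_append_of_ne_nil _ h5]
    have hyr : y 0 ∈ r := by
      have := hB.y_zero_mem
      rw [h1, List.mem_append] at this
      exact this.resolve_right (hy1 0)
    refine ⟨by simp [h2, h6], ?_, hyr, ?_⟩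
    · rw [← h3]
      refine countP_isZ_le_one_of_eq h4 fun i => ?_
      have := hB.count_z_le i
      rw [h1, List.count_append] at this
      omega
    · rw [← hB.head?, h1, List.head?_append_of_ne_nil]
      exact List.ne_nil_of_mem hyr
  · have h3 := (List.append_eq_replicate_iff.1 h2.symm).2.2
    rw [h3, countP_isZ_replicate_x] at hs
    omega

theorem two_le_count_midPart {i : ℕ} (hi : y i ∈ midPart 2 K σ) :
    2 ≤ (midPart 2 K σ).count (y i) := by
  simp only [midPart, List.mem_append, List.mem_replicate, List.mem_flatMap, List.mem_range,
    List.mem_cons] at hi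
  rw [midPart, List.count_append]
  rcases hi with hi | ⟨j, hj, hi⟩
  · rw [hi.2, List.count_replicate_self]; omega
  · have h3 := (infix_flatMap_of_mem (List.mem_range.2 hj) fun i =>
      z (σ (i + 1)) :: List.replicate 2 (y (i + 1))).sublist.count_le (y i)
    have h4 : y i = y (j + 1) := by simpa using hi
    rw [h4] at h3 ⊢
    simp only [List.count_cons, List.count_replicate_self] at h3
    omega

/-- The number of letters `z` in the image of the middle part. -/
theorem countP_isZ_flatMap_midPart_le {g : Letter → List Letter} {r s : List Letter} {e : ℕ}
    (hB : IsBody K σ B) (h : r ++ (midPart 2 K σ).flatMap g ++ s = B ++ List.replicate e x)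
    (hz : ∀ i, z i ∈ midPart 2 K σ → ∀ a ∈ g (z i), ∀ b ∈ g (z i), a = b) :
    ((midPart 2 K σ).flatMap g).countP isZ ≤ K := by
  have hle : ∀ i, ((midPart 2 K σ).flatMap g).count (z i) ≤ 1 := by
    intro i
    have := hB.count_append_le e i
    rw [← h, List.count_append, List.count_append] at this
    omega
  refine (countP_flatMap_le (P := isZ) (Q := isZ) fun l hl => ?_).trans countP_isZ_midPart.le
  have hle' : ∀ i, (midPart 2 K σ).count l * (g l).count (z i) ≤ 1 := fun i =>
    (mul_count_le_count_flatMap _ g l (z i)).trans (hle i)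
  cases l with
  | z i =>
    rw [if_pos (by rfl)]
    refine countP_isZ_le_one_of_eq (hz i hl) fun j => ?_
    have h1 := List.count_pos_iff.2 hl
    have h2 := hle' j
    nlinarith
  | y i =>
    -- `y i` is squared, while every z occurs at most once in B, so the image of `y i` has no z.
    have h2 := two_le_count_midPart hl
    rw [Nat.le_iff_lt_or_eq]
    right
    simp only [isZ]
    rw [List.countP_eq_zero.2]
    · rfl
    intro a ha haz
    cases a with
    | z j =>
      have h3 := List.count_pos_iff.2 ha
      have h4 := hle' j
      nlinarith
    | _ => simp [isZ] at haz
  | _ => simp [midPart] at hl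

theorem z_mem_doubledEnding {i : ℕ} (hi : i < K + 2) : z i ∈ doubledEnding K σ :=
  List.mem_flatMap.2 ⟨i, List.mem_range.2 hi, by simp⟩

theorem z_mem_doubledEnding_first (h : σ 0 < K + 2) : z (K + 2) ∈ doubledEnding K σ :=
  List.mem_flatMap.2 ⟨σ 0, List.mem_range.2 h, by simp⟩

theorem z_mem_doubledEnding_last (h : σ (K + 1) < K + 2) : z (K + 3) ∈ doubledEnding K σ :=
  List.mem_flatMap.2 ⟨σ (K + 1), List.mem_range.2 h, by simp⟩

theorem z_mem_doubledEnding_of_mem_midPart (hσ : ∀ i < K + 2, σ i < K + 2) {i : ℕ}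
    (hi : z i ∈ midPart 2 K σ) : z i ∈ doubledEnding K σ := by
  simp [midPart] at hi
  obtain ⟨j, hj, rfl⟩ := hi
  exact z_mem_doubledEnding (hσ _ (by omega))

variable {g : Letter → List Letter} {P Q s : List Letter}

/-- The letter `x'` in the place of `x`. -/
theorem IsMain.right (hσ : ∀ i < K + 2, σ i < K + 2)
    (hm : IsMain K σ g [x, z (σ 0)] (innerPart K σ) (s ++ [z (σ (K + 1)), x, z (K + 3)])
      (doubledEnding K σ) P Q (y (K + 2)))
    (hs : ∀ a ∈ s, a = x) (ht : ∀ j i, t i ∉ g (z j) ∨ z j ∉ doubledEnding K σ) :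
    g x = [] ∧ y 0 ∈ (innerPart K σ).flatMap g ∧
      z (σ (K + 1)) ∈ g (z (σ (K + 1))) ++ g (z (K + 3)) ∧ z (σ 0) ∈ g (z (K + 2)) ∧
      z (σ (K + 1)) ∉ (innerPart K σ).flatMap g := by
  obtain ⟨hl, -, B, T, e, n, hB, hT, h1, h2⟩ := hm
  simp only [List.flatMap_cons, List.flatMap_nil, List.append_nil, List.append_eq_nil_iff] at hl
  -- The first island of x opens a, so everything before the first x' is erased; this includes x
  -- itself.
  obtain ⟨-, hx, -⟩ := hl
  have hs' : s.flatMap g = [] := by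
    rw [List.flatMap_eq_nil_iff]
    intro a ha
    rw [hs a ha, hx]
  rw [List.flatMap_append, hs', List.nil_append] at h1
  simp only [List.flatMap_cons, List.flatMap_nil, List.append_nil, hx, List.nil_append] at h1
  -- `z j` recurs in the ending, so its image is a factor of xⁿT without t: a power of one letter
  -- other than y.
  have hpiece : ∀ j, z j ∈ doubledEnding K σ →
      (∀ a ∈ g (z j), ∀ b ∈ g (z j), a = b) ∧ ∀ i, y i ∉ g (z j) := by
    intro j hj
    have hi : g (z j) <:+: List.replicate n x ++ T := by
      rw [← h2]
      exact (infix_flatMap_of_mem hj g).trans (List.prefix_append _ _).isInfix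
    exact ⟨hT.eq_of_infix hi fun i => (ht j i).resolve_right (not_not.2 hj),
      hT.y_notMem hi⟩
  have hj := hσ (K + 1) (by omega)
  have hy : ∀ i, y i ∉ g (z (σ (K + 1))) ++ g (z (K + 3)) := by
    intro i
    rw [List.mem_append, not_or]
    exact ⟨(hpiece _ (z_mem_doubledEnding hj)).2 i,
      (hpiece _ (z_mem_doubledEnding_last hj)).2 i⟩
  have h0 := hpiece _ (z_mem_doubledEnding_first (hσ 0 (by omega)))
  rw [innerPart, List.flatMap_cons] at h1
  have hmid := countP_isZ_flatMap_midPart_le hB h1 fun i hi =>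
    (hpiece i (z_mem_doubledEnding_of_mem_midPart hσ hi)).1
  have hcount := congrArg (List.countP isZ) h1
  rw [List.countP_append, List.countP_append, List.countP_append (l₁ := B),
    countP_isZ_replicate_x] at hcount
  have hB2 := hB.le_countP
  have hfirst : (g (z (K + 2))).countP isZ ≤ 1 := by
    refine countP_isZ_le_one_of_eq h0.1 fun i => ?_
    have := hB.count_append_le e i
    rw [← h1, List.count_append, List.count_append] at this
    omega
  -- Of the K + 2 letters z needed, z' gives at most one and the middle part at most K, so the last
  -- group gives at least one.
  obtain ⟨h3, h4, h5, h6⟩ := hB.of_suffix h1 hy (by omega)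
  have hlast : z (σ (K + 1)) ∉ g (z (K + 2)) ++ (midPart 2 K σ).flatMap g := by
    intro h
    have h7 := hB.count_append_le e (σ (K + 1))
    rw [← h1, List.count_append] at h7
    have h8 := List.count_pos_iff.2 h
    have h9 := List.count_pos_iff.2 h3
    omega
  rw [innerPart, List.flatMap_cons]
  refine ⟨hx, h5, h3, ?_, hlast⟩
  -- The last group gives exactly one z, so z' cannot be erased; its image then starts with the
  -- first letter of B.
  have hne : g (z (K + 2)) ≠ [] := by
    intro h
    rw [h, List.countP_nil] at hcount
    omega
  rw [List.head?_append_of_ne_nil _ hne] at h6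
  exact List.mem_of_head? h6

/-- The letter `x` in the place of `x`. -/
theorem IsMain.left (hσ : ∀ i < K + 2, σ i < K + 2)
    (hm : IsMain K σ g [] (z (σ 0) :: y (K + 2) :: (innerPart K σ ++ s)) [z (σ (K + 1))]
      (z (K + 3) :: y (K + 2) :: doubledEnding K σ) P Q x)
    (hs : ∀ a ∈ s, a = y (K + 2)) (ht : ∀ j i, t i ∉ g (z j) ∨ z j ∉ doubledEnding K σ)
    (hx' : g (y (K + 2)) = []) :
    y 0 ∈ (z (σ 0) :: y (K + 2) :: (innerPart K σ ++ s)).flatMap g ∧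
      z (σ (K + 1)) ∈ g (z (σ (K + 1))) := by
  obtain ⟨-, -, B, T, e, n, hB, hT, h1, h2⟩ := hm
  have hs' : s.flatMap g = [] := by
    rw [List.flatMap_eq_nil_iff]
    intro a ha
    rw [hs a ha, hx']
  have e1 : (z (σ 0) :: y (K + 2) :: (innerPart K σ ++ s)).flatMap g =
      g (z (σ 0)) ++ g (z (K + 2)) ++ (midPart 2 K σ).flatMap g := by
    simp [innerPart, hs', hx']
  rw [e1] at h1 ⊢
  simp only [List.flatMap_cons, List.flatMap_nil, List.append_nil, hx', List.nil_append] at h1 h2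
  have hpiece : ∀ j, z j ∈ doubledEnding K σ →
      (∀ a ∈ g (z j), ∀ b ∈ g (z j), a = b) ∧ ∀ i, y i ∉ g (z j) := by
    intro j hj
    have hi : g (z j) <:+: List.replicate n x ++ T := by
      rw [← h2]
      exact (infix_flatMap_of_mem hj g).trans (List.infix_append _ _ _)
    exact ⟨hT.eq_of_infix hi fun i => (ht j i).resolve_right (not_not.2 hj),
      hT.y_notMem hi⟩
  have hj := hpiece _ (z_mem_doubledEnding (hσ (K + 1) (by omega)))
  have ha := hpiece _ (z_mem_doubledEnding (hσ 0 (by omega)))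
  have h0 := hpiece _ (z_mem_doubledEnding_first (hσ 0 (by omega)))
  have hmid := countP_isZ_flatMap_midPart_le hB h1 fun i hi =>
    (hpiece i (z_mem_doubledEnding_of_mem_midPart hσ hi)).1
  have hcount := congrArg (List.countP isZ) h1
  rw [List.countP_append, List.countP_append, List.countP_append, List.countP_append,
    countP_isZ_replicate_x] at hcount
  have hB2 := hB.le_countP
  have hy0 : ∀ i, y i ∉ g (z (σ 0)) ++ g (z (K + 2)) := by
    intro i
    rw [List.mem_append, not_or]
    exact ⟨ha.2 i, h0.2 i⟩
  -- The two images together form a prefix of B without y, hence part of a single island; they share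
  -- one z.
  have hfirst : (g (z (σ 0)) ++ g (z (K + 2))).countP isZ ≤ 1 := by
    have h3 : (g (z (σ 0)) ++ g (z (K + 2))) ++ ((midPart 2 K σ).flatMap g ++
        g (z (σ (K + 1)))) = B ++ List.replicate e x := by simpa using h1
    rcases List.append_eq_append_iff.1 h3 with ⟨b, h4, h5⟩ | ⟨b, h4, h5⟩
    · refine countP_isZ_le_one_of_eq (hB.eq_of_infix ⟨[], b, by simp [h4]⟩ hy0) fun i => ?_
      have := hB.count_z_le i
      rw [h4, List.count_append] at this
      omega
    · exact absurd (by rw [h4]; exact List.mem_append_left _ hB.y_zero_mem) (hy0 0)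
  rw [List.countP_append] at hfirst
  obtain ⟨h3, h4, h5, h6⟩ := hB.of_suffix h1 hj.2 (by omega)
  exact ⟨h5, h3⟩

/-- Either the letter `x'` is erased, or the place of insertion is in the last island of `x`. -/
theorem IsMain.left_cases
    (hm : IsMain K σ g [] (z (σ 0) :: y (K + 2) :: (innerPart K σ ++ s)) [z (σ (K + 1))]
      (z (K + 3) :: y (K + 2) :: doubledEnding K σ) P Q x)
    (ht : ∀ i, t i ∉ g (z (K + 3)) ++ g (y (K + 2))) :
    (∀ a ∈ g (y (K + 2)), a = x) ∧
      (x ∈ g (y (K + 2)) → ∀ a ∈ [z (σ (K + 1))].flatMap g, a = x) := by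
  obtain ⟨-, -, B, T, e, n, hB, hT, h1, h2⟩ := hm
  constructor
  · obtain ⟨T', hT'⟩ := List.head?_eq_some_iff.1 hT.head?
    have h3 : (g (z (K + 3)) ++ g (y (K + 2))) ++ ((doubledEnding K σ).flatMap g ++ Q) =
        List.replicate n x ++ T := by simpa using h2
    have h4 : ∀ a ∈ g (z (K + 3)) ++ g (y (K + 2)), a = x := by
      rcases List.append_eq_append_iff.1 h3 with ⟨b, h4, h5⟩ | ⟨b, h4, h5⟩
      · intro a ha
        refine List.eq_of_mem_replicate (n := n) ?_
        rw [h4]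
        exact List.mem_append_left _ ha
      · rcases b with _ | ⟨c, b⟩
        · intro a ha
          rw [h4, List.append_nil] at ha
          exact List.eq_of_mem_replicate ha
        · rw [hT', List.cons_append, List.cons.injEq] at h5
          exact absurd (by rw [h4, h5.1]; simp) (ht 0)
    exact fun a ha => h4 a (List.mem_append_right _ ha)
  · intro hx a ha
    obtain ⟨c, d, hcd⟩ := List.append_of_mem hx
    have h3 : (g (z (σ 0)) ++ c) ++ x :: (d ++ (innerPart K σ ++ s).flatMap g ++
        [z (σ (K + 1))].flatMap g) = B ++ List.replicate e x := by
      -- The letter x' also occurs between the two letters x. An x in its image there already lies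
      -- in the last island, so only x's follow within B x⋯x.
      rw [← h1]; simp [hcd]
    obtain ⟨-, -, h4⟩ := hB.eq_replicate_of_eq_append h3
    exact h4 a (List.mem_append_right _ ha)

end Main

/-! ### Projections onto `a_{0,k}[π]` -/

/-- The index `A` is sent to `π(1)`, the index `C` to `π(k)`, and the other ones of the four special
indices are erased. -/
def relabel (K : ℕ) (σ : Equiv.Perm ℕ) (A C i : ℕ) : List ℕ :=
  if i = A then [σ 0] else if i = C then [σ (K + 1)] else
    if i = σ 0 ∨ i = σ (K + 1) ∨ i = K + 2 ∨ i = K + 3 then [] else [i]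

/-- The substitution that keeps the letter `X ∈ {x, x'}` and the indices `A`, `C`. -/
def proj (K : ℕ) (σ : Equiv.Perm ℕ) (X : Letter) (A C : ℕ) : Letter → List Letter
  | x => if X = x then [x] else []
  | y i => if i = K + 2 then (if X = y (K + 2) then [x] else []) else [y i]
  | z i => (relabel K σ A C i).map z
  | t i => (relabel K σ A C i).map t

/-- The substitution that keeps the index `a` and `t b`. -/
def mark (a b : ℕ) (S : List Letter) : Letter → List Letter
  | z i => if i = a then [z 0] else []
  | t i => if i = a then S ++ [t 0] else if i = b then [t 1] else []
  | _ => []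

/-- The substitution that keeps the letter `x` and the index `K + 3`. -/
def probe (K : ℕ) (σ : Equiv.Perm ℕ) (R : List Letter) : Letter → List Letter
  | x => [y K]
  | z i => if i = K + 3 then [z (σ (K + 1))] else []
  | t i => if i = K + 3 then R else []
  | _ => []

section Proj

variable {K : ℕ} {σ : Equiv.Perm ℕ} {X : Letter} {A C : ℕ} {u : List Letter} {S R : List Letter}

theorem apply_zero_ne : σ 0 ≠ σ (K + 1) := by simp

theorem mem_relabel_first {i : ℕ} : σ 0 ∈ relabel K σ A C i → i = A := by
  unfold relabel
  split_ifs with h1 h2 h3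
  · exact fun _ => h1
  · intro h; exact absurd (List.mem_singleton.1 h) apply_zero_ne
  · simp
  · intro h; exact absurd (Or.inl (List.mem_singleton.1 h).symm) h3

theorem mem_relabel_last {i : ℕ} : σ (K + 1) ∈ relabel K σ A C i → i = C := by
  unfold relabel
  split_ifs with h1 h2 h3
  · intro h; exact absurd (List.mem_singleton.1 h).symm apply_zero_ne
  · exact fun _ => h2
  · simp
  · intro h; exact absurd (Or.inr (Or.inl (List.mem_singleton.1 h).symm)) h3

theorem mem_of_mem_flatMap_proj {l b : Letter} (hb : ∀ a, b ∈ proj K σ X A C a → a = l)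
    (h : b ∈ u.flatMap (proj K σ X A C)) : l ∈ u := by
  obtain ⟨a, ha, h⟩ := List.mem_flatMap.1 h
  exact hb a h ▸ ha

/-- Applied to projections with different `A`, this puts both versions of the first z into the same
block of the original word. -/
theorem z_first_of_mem (h : z (σ 0) ∈ u.flatMap (proj K σ X A C)) : z A ∈ u := by
  refine mem_of_mem_flatMap_proj (fun a ha => ?_) h
  cases a with
  | z i => exact congrArg z (mem_relabel_first (by simpa [proj] using ha))
  | x => simp only [proj] at ha; split_ifs at ha <;> simp at ha
  | y i => simp only [proj] at ha; split_ifs at ha <;> simp at ha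
  | t i => simp [proj] at ha

theorem t_first_of_mem (h : t (σ 0) ∈ u.flatMap (proj K σ X A C)) : t A ∈ u := by
  refine mem_of_mem_flatMap_proj (fun a ha => ?_) h
  cases a with
  | t i => exact congrArg t (mem_relabel_first (by simpa [proj] using ha))
  | x => simp only [proj] at ha; split_ifs at ha <;> simp at ha
  | y i => simp only [proj] at ha; split_ifs at ha <;> simp at ha
  | z i => simp [proj] at ha

theorem z_last_of_mem (h : z (σ (K + 1)) ∈ u.flatMap (proj K σ X A C)) : z C ∈ u := by
  refine mem_of_mem_flatMap_proj (fun a ha => ?_) h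
  cases a with
  | z i => exact congrArg z (mem_relabel_last (by simpa [proj] using ha))
  | x => simp only [proj] at ha; split_ifs at ha <;> simp at ha
  | y i => simp only [proj] at ha; split_ifs at ha <;> simp at ha
  | t i => simp [proj] at ha

theorem t_last_of_mem (h : t (σ (K + 1)) ∈ u.flatMap (proj K σ X A C)) : t C ∈ u := by
  refine mem_of_mem_flatMap_proj (fun a ha => ?_) h
  cases a with
  | t i => exact congrArg t (mem_relabel_last (by simpa [proj] using ha))
  | x => simp only [proj] at ha; split_ifs at ha <;> simp at ha
  | y i => simp only [proj] at ha; split_ifs at ha <;> simp at ha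
  | z i => simp [proj] at ha

/-- The right side does not depend on `A` and `C`, so occurrences of x transfer between projections
with the same outer letter. -/
theorem x_mem_flatMap_proj (hX : X = x ∨ X = y (K + 2)) :
    x ∈ u.flatMap (proj K σ X A C) ↔ X ∈ u := by
  constructor
  · refine mem_of_mem_flatMap_proj fun a ha => ?_
    cases a with
    | x => simp only [proj] at ha; split_ifs at ha with h <;> simp_all
    | y i => simp only [proj] at ha; split_ifs at ha <;> simp_all
    | z i => simp [proj] at ha
    | t i => simp [proj] at ha
  · intro h
    refine List.mem_flatMap.2 ⟨X, h, ?_⟩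
    rcases hX with rfl | rfl <;> simp [proj]

theorem y_zero_mem_flatMap_proj : y 0 ∈ u.flatMap (proj K σ X A C) ↔ y 0 ∈ u := by
  constructor
  · refine mem_of_mem_flatMap_proj fun a ha => ?_
    cases a with
    | x => simp only [proj] at ha; split_ifs at ha <;> simp at ha
    | y i => simp only [proj] at ha; split_ifs at ha <;> simp_all
    | z i => simp [proj] at ha
    | t i => simp [proj] at ha
  · exact fun h => List.mem_flatMap.2 ⟨_, h, by simp [proj]⟩

theorem relabel_first : relabel K σ A C A = [σ 0] := by simp [relabel]

theorem relabel_last (h : A ≠ C) : relabel K σ A C C = [σ (K + 1)] := by simp [relabel, h.symm]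

theorem relabel_of_ne {i : ℕ} (hA : A = σ 0 ∨ A = K + 2) (hC : C = σ (K + 1) ∨ C = K + 3)
    (h1 : i ≠ σ 0) (h2 : i ≠ σ (K + 1)) (h3 : i < K + 2) : relabel K σ A C i = [i] := by
  unfold relabel
  rw [if_neg, if_neg, if_neg]
  · omega
  · rcases hC with rfl | rfl <;> omega
  · rcases hA with rfl | rfl <;> omega

theorem flatMap_proj_midPart (hσ : ∀ i < K + 2, σ i < K + 2) (hA : A = σ 0 ∨ A = K + 2)
    (hC : C = σ (K + 1) ∨ C = K + 3) :
    (midPart 2 K σ).flatMap (proj K σ X A C) = midPart 2 K σ := by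
  rw [midPart, List.flatMap_append, List.flatMap_assoc]
  refine congrArg₂ _ ?_ ?_
  · simp [proj, List.replicate_succ]
  · refine List.flatMap_congr fun i hi => ?_
    rw [List.mem_range] at hi
    have h1 : σ (i + 1) ≠ σ 0 := by simp
    have h2 : σ (i + 1) ≠ σ (K + 1) := by simp; omega
    have h3 : i ≠ K + 1 := by omega
    simp [proj, relabel_of_ne hA hC h1 h2 (hσ _ (by omega)), List.replicate_succ, h3]

theorem flatMap_proj_doubledEnding (hσ : ∀ i < K + 2, σ i < K + 2) (hA : A = σ 0 ∨ A = K + 2)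
    (hC : C = σ (K + 1) ∨ C = K + 3) :
    (doubledEnding K σ).flatMap (proj K σ X A C) = ending K := by
  rw [doubledEnding, List.flatMap_assoc]
  refine List.flatMap_congr fun i hi => ?_
  rw [List.mem_range] at hi
  have h0 := hσ 0 (by omega)
  have hl := hσ (K + 1) (by omega)
  have hne := apply_zero_ne (K := K) (σ := σ)
  by_cases h1 : i = σ 0
  · have h2 : i ≠ σ (K + 1) := h1 ▸ hne
    rw [if_pos h1, if_neg h2]
    rcases hA with rfl | rfl
    · have h3 : relabel K σ (σ 0) C (K + 2) = [] := by
        unfold relabel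
        rw [if_neg (by omega), if_neg (by omega), if_pos (by simp)]
      simp [proj, h1, relabel_first, h3]
    · have h3 : relabel K σ (K + 2) C (σ 0) = [] := by
        unfold relabel
        rw [if_neg (by omega), if_neg (by omega), if_pos (by simp)]
      simp [proj, h1, relabel_first, h3]
  · by_cases h2 : i = σ (K + 1)
    · rw [if_neg h1, if_pos h2]
      have hAC : A ≠ C := by omega
      rcases hC with rfl | rfl
      · have h3 : relabel K σ A (σ (K + 1)) (K + 3) = [] := by
          unfold relabel
          rw [if_neg (by omega), if_neg (by omega), if_pos (by simp)]
        simp [proj, h2, relabel_last hAC, h3]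
      · have h3 : relabel K σ A (K + 3) (σ (K + 1)) = [] := by
          unfold relabel
          rw [if_neg (by omega), if_neg (by omega), if_pos (by simp)]
        simp [proj, h2, relabel_last hAC, h3]
    · simp [h1, h2, proj, relabel_of_ne hA hC h1 h2 hi]

theorem flatMap_range_eq {α : Type*} {n a : ℕ} (ha : a < n) {F : ℕ → List α}
    (h : ∀ i < n, i ≠ a → F i = []) : (List.range n).flatMap F = F a := by
  obtain ⟨l₁, l₂, hl⟩ := List.append_of_mem (List.mem_range.2 ha)
  have hn := List.nodup_range (n := n)
  have hm : ∀ i ∈ l₁ ++ a :: l₂, i < n := fun i hi => List.mem_range.1 (hl ▸ hi)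
  rw [hl, List.nodup_append, List.nodup_cons] at hn
  rw [hl, List.flatMap_append, List.flatMap_cons, List.flatMap_eq_nil_iff.2, List.nil_append,
    List.flatMap_eq_nil_iff.2, List.append_nil]
  · exact fun i hi => h i (hm i (by simp [hi])) fun e => hn.2.1.1 (e ▸ hi)
  · exact fun i hi => h i (hm i (by simp [hi])) fun e => hn.2.2 i hi a (by simp) e

theorem flatMap_mark_doubledEnding (hσ : ∀ i < K + 2, σ i < K + 2) {a b : ℕ}
    (h : a = σ 0 ∧ b = K + 2 ∨ a = σ (K + 1) ∧ b = K + 3) :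
    (doubledEnding K σ).flatMap (mark a b S) = S ++ [t 0, z 0, t 1] := by
  have h0 := hσ 0 (by omega)
  have hl := hσ (K + 1) (by omega)
  have hne := apply_zero_ne (K := K) (σ := σ)
  rw [doubledEnding, List.flatMap_assoc, flatMap_range_eq (a := a) (by omega)]
  · rcases h with ⟨rfl, rfl⟩ | ⟨rfl, rfl⟩
    · have : K + 2 ≠ σ 0 := by omega
      simp [mark, this]
    · have : K + 3 ≠ σ (K + 1) := by omega
      simp [mark, this, hne.symm]
  · intro i hi hia
    have h1 : i ≠ b := by omega
    have h2 : i = σ 0 → K + 2 ≠ a ∧ K + 2 ≠ b := by omega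
    have h3 : i = σ (K + 1) → K + 3 ≠ a ∧ K + 3 ≠ b := by omega
    simp only [mark, List.flatMap_append, List.flatMap_cons, List.flatMap_nil, hia, h1, if_false,
      List.append_nil, List.nil_append]
    split_ifs with h4 h5 <;> simp_all [mark]

theorem flatMap_mark_midPart_first : (midPart 2 K σ).flatMap (mark (σ 0) (K + 2) S) = [] := by
  rw [List.flatMap_eq_nil_iff]
  intro l hl
  cases l with
  | z i =>
    obtain ⟨j, -, h⟩ : ∃ j < K, i = σ (j + 1) := by simpa [midPart] using hl
    simp [mark, h]
  | t i => simp [midPart] at hl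
  | _ => rfl

theorem flatMap_mark_midPart_last :
    (midPart 2 K σ).flatMap (mark (σ (K + 1)) (K + 3) S) = [] := by
  rw [List.flatMap_eq_nil_iff]
  intro l hl
  cases l with
  | z i =>
    obtain ⟨j, hj, h⟩ : ∃ j < K, i = σ (j + 1) := by simpa [midPart] using hl
    have : j ≠ K := by omega
    simp [mark, h, this]
  | t i => simp [midPart] at hl
  | _ => rfl

theorem flatMap_mark_doubledWord_first (hσ : ∀ i < K + 2, σ i < K + 2) :
    (doubledWord K σ []).flatMap (mark (σ 0) (K + 2) S) = z 0 :: (S ++ [t 0, z 0, t 1]) := by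
  have h1 := flatMap_mark_doubledEnding (S := S) hσ (Or.inl ⟨rfl, rfl⟩)
  have h0 := hσ 0 (by omega)
  have h3 : K + 2 ≠ σ 0 := by omega
  have h4 : K + 3 ≠ σ 0 := by omega
  simp [doubledWord, innerPart, h1, flatMap_mark_midPart_first]
  simp [mark, h3, h4]

theorem flatMap_mark_doubledWord_last (hσ : ∀ i < K + 2, σ i < K + 2) :
    (doubledWord K σ []).flatMap (mark (σ (K + 1)) (K + 3) S) =
      z 0 :: (S ++ [t 0, z 0, t 1]) := by
  have h1 := flatMap_mark_doubledEnding (S := S) hσ (Or.inr ⟨rfl, rfl⟩)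
  have h0 := hσ (K + 1) (by omega)
  have h3 : K + 2 ≠ σ (K + 1) := by omega
  have h4 : K + 3 ≠ σ (K + 1) := by omega
  simp [doubledWord, innerPart, h1, flatMap_mark_midPart_last]
  simp [mark, h3, h4]

theorem flatMap_probe_doubledWord (hσ : ∀ i < K + 2, σ i < K + 2) :
    (doubledWord K σ []).flatMap (probe K σ R) =
      [y K, y K] ++ (z (σ (K + 1)) :: (R ++ [z (σ (K + 1))])) := by
  have h0 := hσ 0 (by omega)
  have hl := hσ (K + 1) (by omega)
  have hne := apply_zero_ne (K := K) (σ := σ)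
  have h1 : (doubledEnding K σ).flatMap (probe K σ R) = R ++ [z (σ (K + 1))] := by
    rw [doubledEnding, List.flatMap_assoc, flatMap_range_eq hl]
    · have : σ (K + 1) ≠ K + 3 := by omega
      simp [probe, this, hne.symm]
    · intro i hi hia
      have h1 : i ≠ K + 3 := by omega
      simp only [hia, if_false]
      split_ifs with h4 <;> simp [probe, h1]
  have h2 : (midPart 2 K σ).flatMap (probe K σ R) = [] := by
    rw [List.flatMap_eq_nil_iff]
    intro l hl
    cases l with
    | z i =>
      obtain ⟨j, hj, h⟩ : ∃ j < K, i = σ (j + 1) := by simpa [midPart] using hl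
      have := hσ (j + 1) (by omega)
      have : σ (j + 1) ≠ K + 3 := by omega
      simp [probe, h, this]
    | t i => simp [midPart] at hl
    | x => simp [midPart] at hl
    | _ => rfl
  have h3 : σ 0 ≠ K + 3 := by omega
  have h4 : σ (K + 1) ≠ K + 3 := by omega
  simp [doubledWord, innerPart, h1, h2]
  simp [probe, h3, h4]

theorem flatMap_proj_doubledWord (hσ : ∀ i < K + 2, σ i < K + 2)
    (h : X = x ∧ C = σ (K + 1) ∧ (A = σ 0 ∨ A = K + 2) ∨
      X = y (K + 2) ∧ A = K + 2 ∧ (C = σ (K + 1) ∨ C = K + 3)) :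
    (doubledWord K σ []).flatMap (proj K σ X A C) = wordA K σ := by
  have hA : A = σ 0 ∨ A = K + 2 := by tauto
  have hC : C = σ (K + 1) ∨ C = K + 3 := by tauto
  have h0 := hσ 0 (by omega)
  have hl := hσ (K + 1) (by omega)
  have hne := apply_zero_ne (K := K) (σ := σ)
  have e1 : ∀ C, relabel K σ (K + 2) C (σ 0) = [] ∨ C = σ 0 := by
    intro C
    by_cases h : C = σ 0
    · exact Or.inr h
    · left
      unfold relabel
      rw [if_neg (by omega), if_neg (fun e => h e.symm), if_pos (by simp)]
  have e2 : relabel K σ (σ 0) (σ (K + 1)) (K + 2) = [] := by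
    unfold relabel
    rw [if_neg (by omega), if_neg (by omega), if_pos (by simp)]
  have e3 : ∀ A, A < K + 3 → relabel K σ A (σ (K + 1)) (K + 3) = [] := by
    intro A hA
    unfold relabel
    rw [if_neg (by omega), if_neg (by omega), if_pos (by simp)]
  have e4 : relabel K σ (K + 2) (K + 3) (σ (K + 1)) = [] := by
    unfold relabel
    rw [if_neg (by omega), if_neg (by omega), if_pos (by simp)]
  have e5 := (e1 (σ (K + 1))).resolve_right hne.symm
  have e6 := (e1 (K + 3)).resolve_right (by omega)
  have e7 : ∀ A, A < K + 3 → A ≠ σ (K + 1) → relabel K σ A (σ (K + 1)) (σ (K + 1)) = [σ (K + 1)] :=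
    fun A _ h => relabel_last h
  have e8 : relabel K σ (K + 2) (K + 3) (K + 3) = [σ (K + 1)] := relabel_last (by omega)
  have f1 := flatMap_proj_midPart (X := X) hσ hA hC
  have f2 := flatMap_proj_doubledEnding (X := X) hσ hA hC
  simp only [doubledWord, innerPart, wordA, body, List.flatMap_cons, List.flatMap_append, f1, f2,
    List.cons_append, List.flatMap_nil]
  rcases h with ⟨rfl, rfl, rfl | rfl⟩ | ⟨rfl, rfl, rfl | rfl⟩
  · simp [proj, relabel_first, e2, e3 (σ 0) (by omega), e7 (σ 0) (by omega) hne]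
  · simp [proj, relabel_first, e5, e3 (K + 2) (by omega), e7 (K + 2) (by omega) (by omega)]
  · simp [proj, relabel_first, e5, e3 (K + 2) (by omega), e7 (K + 2) (by omega) (by omega)]
  · simp [proj, relabel_first, e4, e6, e8]

end Proj

/-! ### The identities are stable -/

/-- A factor that is not a prefix. -/
def IsInnerFactor (f w : List Letter) : Prop := ∃ f₁ f₂, f₁ ≠ [] ∧ w = f₁ ++ f ++ f₂

section Patterns

variable {K : ℕ} {σ : Equiv.Perm ℕ} {p q s f : List Letter} {φ h : Letter → List Letter}

theorem z_mem_of_mem_doubledEnding (hσ : ∀ i, σ i < K + 2 ↔ i < K + 2) {i : ℕ}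
    (hi : z i ∈ doubledEnding K σ) : z i ∈ x :: z (σ 0) :: y (K + 2) :: (innerPart K σ ++
      (s ++ z (σ (K + 1)) :: x :: [z (K + 3), y (K + 2)])) := by
  have h1 : i < K + 2 ∨ i = K + 2 ∨ i = K + 3 := by
    obtain ⟨j, hj, h⟩ := List.mem_flatMap.1 hi
    rw [List.mem_range] at hj
    split_ifs at h <;> simp at h <;> omega
  rcases h1 with h1 | rfl | rfl
  · obtain ⟨j, rfl⟩ := σ.surjective i
    rw [hσ] at h1
    rcases j with _ | j
    · simp
    · by_cases hj : j = K
      · simp [hj]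
      · have : z (σ (j + 1)) ∈ midPart 2 K σ := by
          simp [midPart]
          omega
        simp [innerPart, this]
  · simp [innerPart]
  · simp

theorem doubledWord_eq : doubledWord K σ s = (x :: z (σ 0) :: y (K + 2) :: (innerPart K σ ++
    (s ++ z (σ (K + 1)) :: x :: [z (K + 3), y (K + 2)]))) ++ doubledEnding K σ := by
  simp [doubledWord]

theorem two_le_count_doubledWord_z (hσ : ∀ i, σ i < K + 2 ↔ i < K + 2) {i : ℕ}
    (hi : z i ∈ doubledEnding K σ) : 2 ≤ (doubledWord K σ s).count (z i) := by
  rw [doubledWord_eq, List.count_append]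
  have h1 := List.count_pos_iff.2 hi
  have h2 := List.count_pos_iff.2 (z_mem_of_mem_doubledEnding (s := s) hσ hi)
  omega

theorem two_le_count_doubledWord (hσ : ∀ i, σ i < K + 2 ↔ i < K + 2)
    (hs : ∀ a ∈ s, a = x ∨ a = y (K + 2)) {l : Letter}
    (hl : l ∈ x :: z (σ 0) :: y (K + 2) :: (innerPart K σ ++
      (s ++ z (σ (K + 1)) :: x :: [z (K + 3), y (K + 2)]))) :
    2 ≤ (doubledWord K σ s).count l := by
  have h0 := (hσ 0).2 (by omega)
  have hk := (hσ (K + 1)).2 (by omega)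
  cases l with
  | x => simp [doubledWord]; omega
  | y i =>
    by_cases hi : i = K + 2
    · subst hi; simp [doubledWord]; omega
    · have hm : y i ∈ midPart 2 K σ := by
        have : y i ∉ s := fun h => by have := hs _ h; simp_all
        simpa [innerPart, hi, this] using hl
      refine (two_le_count_midPart hm).trans (List.Sublist.count_le _ (List.IsInfix.sublist
        ⟨[x, z (σ 0), y (K + 2), z (K + 2)], s ++ z (σ (K + 1)) :: x :: z (K + 3) ::
          y (K + 2) :: doubledEnding K σ, ?_⟩))
      simp [doubledWord, innerPart]
  | z i =>
    refine two_le_count_doubledWord_z hσ ?_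
    have hm : z i ∉ s := fun h => by have := hs _ h; simp at this
    simp only [innerPart, List.mem_cons, List.mem_append, hm, List.cons_append, z.injEq,
      reduceCtorEq, false_or, List.not_mem_nil, or_false] at hl
    rcases hl with rfl | rfl | hl | rfl | rfl
    · exact z_mem_doubledEnding h0
    · exact z_mem_doubledEnding_first h0
    · exact z_mem_doubledEnding_of_mem_midPart (fun i => (hσ i).2) hl
    · exact z_mem_doubledEnding hk
    · exact z_mem_doubledEnding_last hk
  | t i =>
    have hm : t i ∉ s := fun h => by have := hs _ h; simp at this
    simp [innerPart, midPart, hm] at hl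

/-- A substitution instance of the word `doubledWord K σ s`, inside a word. -/
abbrev inst (K : ℕ) (σ : Equiv.Perm ℕ) (φ : Letter → List Letter) (p q s : List Letter) :
    List Letter := p ++ (doubledWord K σ s).flatMap φ ++ q

theorem doubledWord_right : doubledWord K σ s = [x, z (σ 0)] ++ [y (K + 2)] ++ innerPart K σ ++
    (s ++ [z (σ (K + 1)), x, z (K + 3)]) ++ [y (K + 2)] ++ doubledEnding K σ := by
  simp [doubledWord]

theorem doubledWord_right_cons : doubledWord K σ (y (K + 2) :: s) = [x, z (σ 0)] ++ [y (K + 2)] ++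
    innerPart K σ ++ [y (K + 2)] ++ (s ++ [z (σ (K + 1)), x, z (K + 3)]) ++ [y (K + 2)] ++
    doubledEnding K σ := by
  simp [doubledWord]

theorem doubledWord_left : doubledWord K σ s = [] ++ [x] ++ (z (σ 0) :: y (K + 2) ::
    (innerPart K σ ++ s)) ++ [z (σ (K + 1))] ++ [x] ++
    (z (K + 3) :: y (K + 2) :: doubledEnding K σ) := by
  simp [doubledWord]

theorem doubledWord_left_concat : doubledWord K σ (s ++ [x]) = [] ++ [x] ++ (z (σ 0) ::
    y (K + 2) :: (innerPart K σ ++ s)) ++ [x] ++ [z (σ (K + 1))] ++ [x] ++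
    (z (K + 3) :: y (K + 2) :: doubledEnding K σ) := by
  simp [doubledWord]

theorem right_delete (hσ : ∀ i, σ i < K + 2 ↔ i < K + 2) (hs : ∀ a ∈ s, a = x) {f₁ f₂ : List Letter}
    (hf : wordA K σ = f₁ ++ f ++ f₂)
    (hu : LambdaList ((inst K σ φ p q (y (K + 2) :: s)).flatMap h) f) :
    LambdaList ((inst K σ φ p q s).flatMap h) f := by
  rw [inst, doubledWord_right_cons] at hu
  rw [inst, doubledWord_right]
  refine pattern_delete hf (fun l hl => ?_) hu
  rw [← doubledWord_right_cons]
  refine two_le_count_doubledWord hσ (fun a ha => ?_) ?_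
  · rcases List.mem_cons.1 ha with rfl | ha
    · exact Or.inr rfl
    · exact Or.inl (hs a ha)
  · simp at hl ⊢; tauto

theorem left_delete (hσ : ∀ i, σ i < K + 2 ↔ i < K + 2) (hs : ∀ a ∈ s, a = y (K + 2))
    {f₁ f₂ : List Letter} (hf : wordA K σ = f₁ ++ f ++ f₂)
    (hu : LambdaList ((inst K σ φ p q (s ++ [x])).flatMap h) f) :
    LambdaList ((inst K σ φ p q s).flatMap h) f := by
  rw [inst, doubledWord_left_concat] at hu
  rw [inst, doubledWord_left]
  refine pattern_delete hf (fun l hl => ?_) hu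
  rw [← doubledWord_left_concat]
  refine two_le_count_doubledWord hσ (fun a ha => ?_) ?_
  · rcases List.mem_append.1 ha with ha | ha
    · exact Or.inr (hs a ha)
    · exact Or.inl (by simpa using ha)
  · simp at hl ⊢; tauto

/-- The insertion of the letter `X` between `R` and `S` does not change the `λ`-class. -/
def Harmless (g : Letter → List Letter) (X : Letter) (R S : List Letter) : Prop :=
  g X = [] ∨ ∃ d, ∀ e ∈ g X ++ R.flatMap g ++ S.flatMap g, e = d

theorem Harmless.eq {g : Letter → List Letter} {X : Letter} {R S : List Letter}
    (hg : Harmless g X R S) {a b : Letter} (ha : a ∈ g X) (hb : b ∈ R.flatMap g) : a = b := by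
  rcases hg with hg | ⟨d, hd⟩
  · simp [hg] at ha
  · rw [hd a (by simp [ha]), hd b (List.mem_append_left _ (List.mem_append_right _ hb))]

theorem right_cases (hσ : ∀ i, σ i < K + 2 ↔ i < K + 2) (hs : ∀ a ∈ s, a = x)
    {f₁ f₂ : List Letter} (hf : wordA K σ = f₁ ++ f ++ f₂)
    (hu : LambdaList ((inst K σ φ p q s).flatMap h) f) :
    Harmless (fun l => (φ l).flatMap h) (y (K + 2)) (innerPart K σ)
      (s ++ [z (σ (K + 1)), x, z (K + 3)]) ∨
    (f₁ = [] ∧ IsMain K σ (fun l => (φ l).flatMap h) [x, z (σ 0)] (innerPart K σ)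
      (s ++ [z (σ (K + 1)), x, z (K + 3)]) (doubledEnding K σ) (p.flatMap h)
      (q.flatMap h ++ f₂) (y (K + 2))) := by
  rw [inst, doubledWord_right] at hu
  refine pattern_cases hf (fun l hl => ?_) hu
  rw [← doubledWord_right]
  refine two_le_count_doubledWord hσ (fun a ha => Or.inl (hs a ha)) ?_
  simp at hl ⊢; tauto

theorem left_cases (hσ : ∀ i, σ i < K + 2 ↔ i < K + 2) (hs : ∀ a ∈ s, a = y (K + 2))
    {f₁ f₂ : List Letter} (hf : wordA K σ = f₁ ++ f ++ f₂)
    (hu : LambdaList ((inst K σ φ p q s).flatMap h) f) :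
    Harmless (fun l => (φ l).flatMap h) x (z (σ 0) :: y (K + 2) :: (innerPart K σ ++ s))
      [z (σ (K + 1))] ∨
    (f₁ = [] ∧ IsMain K σ (fun l => (φ l).flatMap h) [] (z (σ 0) :: y (K + 2) ::
      (innerPart K σ ++ s)) [z (σ (K + 1))] (z (K + 3) :: y (K + 2) :: doubledEnding K σ)
      (p.flatMap h) (q.flatMap h ++ f₂) x) := by
  rw [inst, doubledWord_left] at hu
  refine pattern_cases hf (fun l hl => ?_) hu
  rw [← doubledWord_left]
  refine two_le_count_doubledWord hσ (fun a ha => Or.inr (hs a ha)) ?_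
  simp at hl ⊢; tauto

theorem right_insert
    (hg : Harmless (fun l => (φ l).flatMap h) (y (K + 2)) (innerPart K σ)
      (s ++ [z (σ (K + 1)), x, z (K + 3)]))
    (hu : LambdaList ((inst K σ φ p q s).flatMap h) f) :
    LambdaList ((inst K σ φ p q (y (K + 2) :: s)).flatMap h) f := by
  rw [inst, doubledWord_right] at hu
  rw [inst, doubledWord_right_cons]
  exact pattern_insert_of_eq hg hu

theorem left_insert
    (hg : Harmless (fun l => (φ l).flatMap h) x (z (σ 0) :: y (K + 2) :: (innerPart K σ ++ s))
      [z (σ (K + 1))])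
    (hu : LambdaList ((inst K σ φ p q s).flatMap h) f) :
    LambdaList ((inst K σ φ p q (s ++ [x])).flatMap h) f := by
  rw [inst, doubledWord_left] at hu
  rw [inst, doubledWord_left_concat]
  exact pattern_insert_of_eq hg hu

theorem left_insert_of_eq_x (hX : (φ x).flatMap h = [x])
    (hS : ∀ e ∈ (φ (z (σ (K + 1)))).flatMap h, e = x)
    (hu : LambdaList ((inst K σ φ p q s).flatMap h) f) :
    LambdaList ((inst K σ φ p q (s ++ [x])).flatMap h) f := by
  rw [inst, doubledWord_left] at hu
  rw [inst, doubledWord_left_concat]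
  exact pattern_insert_of_eq_x hX (by simpa using hS) hu

/-- For an inner factor the main case is excluded, so both insertion and deletion are safe. This
covers the conditions given by `mark` and `probe`. -/
theorem right_iff (hσ : ∀ i, σ i < K + 2 ↔ i < K + 2) (hs : ∀ a ∈ s, a = x)
    (hf : IsInnerFactor f (wordA K σ)) :
    LambdaList ((inst K σ φ p q s).flatMap h) f ↔
      LambdaList ((inst K σ φ p q (y (K + 2) :: s)).flatMap h) f := by
  obtain ⟨f₁, f₂, hne, hf⟩ := hf
  exact ⟨fun hu => right_insert ((right_cases hσ hs hf hu).resolve_right fun h => hne h.1) hu,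
    right_delete hσ hs hf⟩

theorem left_iff (hσ : ∀ i, σ i < K + 2 ↔ i < K + 2) (hs : ∀ a ∈ s, a = y (K + 2))
    (hf : IsInnerFactor f (wordA K σ)) :
    LambdaList ((inst K σ φ p q s).flatMap h) f ↔
      LambdaList ((inst K σ φ p q (s ++ [x])).flatMap h) f := by
  obtain ⟨f₁, f₂, hne, hf⟩ := hf
  exact ⟨fun hu => left_insert ((left_cases hσ hs hf hu).resolve_right fun h => hne h.1) hu,
    left_delete hσ hs hf⟩

theorem t_notMem_inst (hσ : ∀ i, σ i < K + 2 ↔ i < K + 2) (hs : ∀ a ∈ s, a = x ∨ a = y (K + 2))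
    {f₁ f₂ : List Letter} (hf : wordA K σ = f₁ ++ f ++ f₂)
    (hu : LambdaList ((inst K σ φ p q s).flatMap h) f) (j i : ℕ) :
    t i ∉ (φ (z j)).flatMap h ∨ z j ∉ doubledEnding K σ := by
  by_cases hj : z j ∈ doubledEnding K σ
  · exact Or.inl (t_notMem_of_count hf hu (two_le_count_doubledWord_z hσ hj) i)
  · exact Or.inr hj

/-- A substitution maps `x'` in `doubledWord K σ s` to the two islands `x` of `a_{0,k}[π]`. -/
structure RightMain (K : ℕ) (σ : Equiv.Perm ℕ) (h φ : Letter → List Letter) (p : List Letter) :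
    Prop where
  apply_eq : (φ (y (K + 2))).flatMap h = [x]
  left_eq : p.flatMap h = []
  apply_x : (φ x).flatMap h = []
  apply_first : (φ (z (σ 0))).flatMap h = []
  y_mem : y 0 ∈ ((innerPart K σ).flatMap φ).flatMap h
  last_mem : z (σ (K + 1)) ∈ (φ (z (σ (K + 1))) ++ φ (z (K + 3))).flatMap h
  first_mem : z (σ 0) ∈ (φ (z (K + 2))).flatMap h
  last_notMem : z (σ (K + 1)) ∉ ((innerPart K σ).flatMap φ).flatMap h

/-- A substitution maps `x` in `doubledWord K σ s` to the two islands `x` of `a_{0,k}[π]`, and it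
erases `x'`. -/
structure LeftMain (K : ℕ) (σ : Equiv.Perm ℕ) (h φ : Letter → List Letter) (s : List Letter) :
    Prop where
  apply_eq : (φ x).flatMap h = [x]
  apply_y : (φ (y (K + 2))).flatMap h = []
  y_mem : y 0 ∈ ((z (σ 0) :: y (K + 2) :: (innerPart K σ ++ s)).flatMap φ).flatMap h
  last_mem : z (σ (K + 1)) ∈ (φ (z (σ (K + 1)))).flatMap h

theorem harmless_or_rightMain (hσ : ∀ i, σ i < K + 2 ↔ i < K + 2) (hs : ∀ a ∈ s, a = x)
    (hu : LambdaList ((inst K σ φ p q s).flatMap h) (wordA K σ)) :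
    Harmless (fun l => (φ l).flatMap h) (y (K + 2)) (innerPart K σ)
      (s ++ [z (σ (K + 1)), x, z (K + 3)]) ∨ RightMain K σ h φ p := by
  have hf : wordA K σ = [] ++ wordA K σ ++ [] := by simp
  refine (right_cases hσ hs hf hu).imp_right fun hm' => ?_
  have hm := hm'.2
  obtain ⟨h1, h2, h3, h4, h5⟩ := hm.right (fun i => (hσ i).2) hs
    (t_notMem_inst hσ (fun a ha => Or.inl (hs a ha)) hf hu)
  have h6 := hm.left_eq
  simp only [List.flatMap_cons, List.flatMap_nil, List.append_nil, List.append_eq_nil_iff] at h6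
  refine ⟨hm.apply_eq, h6.1, h1, h6.2.2, ?_, ?_, h4, ?_⟩
  · rw [List.flatMap_assoc]; exact h2
  · rw [List.flatMap_append]; exact h3
  · rw [List.flatMap_assoc]; exact h5

/-- In the middle alternative the image of x' meets the last island of x, so the new x is inserted
into that island and the λ-class does not change. -/
theorem harmless_or_leftMain (hσ : ∀ i, σ i < K + 2 ↔ i < K + 2) (hs : ∀ a ∈ s, a = y (K + 2))
    (hu : LambdaList ((inst K σ φ p q s).flatMap h) (wordA K σ)) :
    Harmless (fun l => (φ l).flatMap h) x (z (σ 0) :: y (K + 2) :: (innerPart K σ ++ s))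
      [z (σ (K + 1))] ∨
    ((φ x).flatMap h = [x] ∧ x ∈ (φ (y (K + 2))).flatMap h ∧
      ∀ e ∈ (φ (z (σ (K + 1)))).flatMap h, e = x) ∨ LeftMain K σ h φ s := by
  have hf : wordA K σ = [] ++ wordA K σ ++ [] := by simp
  have hs' : ∀ a ∈ s, a = x ∨ a = y (K + 2) := fun a ha => Or.inr (hs a ha)
  have ht := t_notMem_inst hσ hs' hf hu
  refine (left_cases hσ hs hf hu).imp_right fun hm' => ?_
  have hm := hm'.2
  have hk := (hσ (K + 1)).2 (by omega)
  obtain ⟨h1, h2⟩ := hm.left_cases fun i => by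
    rw [List.mem_append, not_or]
    exact ⟨(ht _ i).resolve_right (not_not.2 (z_mem_doubledEnding_last hk)),
      t_notMem_of_count hf hu (two_le_count_doubledWord hσ hs' (by simp)) i⟩
  by_cases hx : x ∈ (φ (y (K + 2))).flatMap h
  · exact Or.inl ⟨hm.apply_eq, hx, by simpa using h2 hx⟩
  · have h3 : (φ (y (K + 2))).flatMap h = [] := by
      rw [List.eq_nil_iff_forall_not_mem]
      intro a ha
      exact hx (h1 a ha ▸ ha)
    obtain ⟨h4, h5⟩ := hm.left (fun i => (hσ i).2) hs ht h3
    exact Or.inr ⟨hm.apply_eq, h3, by rw [List.flatMap_assoc]; exact h4, h5⟩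

end Patterns

/-! ### Three stable sets of words -/

/-- The words that the projections with `x` map to `a_{0,k}[π]`. -/
structure InFirst (K : ℕ) (σ : Equiv.Perm ℕ) (S u : List Letter) : Prop where
  proj_first : LambdaList (u.flatMap (proj K σ x (σ 0) (σ (K + 1)))) (wordA K σ)
  proj_double : LambdaList (u.flatMap (proj K σ x (K + 2) (σ (K + 1)))) (wordA K σ)
  mark : LambdaList (u.flatMap (mark (σ 0) (K + 2) S)) (z 0 :: (S ++ [t 0, z 0, t 1]))

/-- The words that the projections with `x'` map to `a_{0,k}[π]`. -/
structure InSecond (K : ℕ) (σ : Equiv.Perm ℕ) (S u : List Letter) : Prop where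
  proj_last : LambdaList (u.flatMap (proj K σ (y (K + 2)) (K + 2) (σ (K + 1)))) (wordA K σ)
  proj_double : LambdaList (u.flatMap (proj K σ (y (K + 2)) (K + 2) (K + 3))) (wordA K σ)
  mark : LambdaList (u.flatMap (mark (σ (K + 1)) (K + 3) S)) (z 0 :: (S ++ [t 0, z 0, t 1]))

/-- A condition that implies that no letter `x` occurs after the double of `z_{π(k)}`. -/
def InThird (K : ℕ) (σ : Equiv.Perm ℕ) (R u : List Letter) : Prop :=
  LambdaList (u.flatMap (probe K σ R)) ([y K, y K] ++ (z (σ (K + 1)) :: (R ++ [z (σ (K + 1))])))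

/-! ### Order of occurrences in the three sets. -/

section Order

variable {K : ℕ} {σ : Equiv.Perm ℕ}

theorem sublist_right_of_notMem {α : Type*} {a b : α} {l r : List α} (h : [a, b] <+ l ++ r)
    (ha : a ∉ l) : [a, b] <+ r := by
  obtain ⟨s₁, s₂, h1, h2, h3⟩ := List.sublist_append_iff.1 h
  rcases s₁ with _ | ⟨c, s₁⟩
  · rw [List.nil_append] at h1; exact h1 ▸ h3
  · rw [List.cons_append, List.cons.injEq] at h1
    exact absurd (h2.subset (by simp [h1.1])) ha

theorem pair_sublist {α : Type*} {a b : α} {l r : List α} (ha : a ∈ l) (hb : b ∈ r) :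
    [a, b] <+ l ++ r :=
  (List.singleton_sublist.2 ha).append (List.singleton_sublist.2 hb)

/-- At most one letter `z_i` occurs before the letter `t_i`. -/
theorem LambdaList.count_z_le_of_t {α β : List Letter} {i : ℕ}
    (h : LambdaList (α ++ t i :: β) (wordA K σ)) : α.count (z i) ≤ 1 := by
  obtain ⟨B, n, T, hu, hB, hT⟩ := h.exists_of_wordA
  have hu' : α ++ t i :: β = (x :: (B ++ List.replicate (n + 1) x)) ++ T := by simpa using hu
  rcases List.append_eq_append_iff.1 hu' with ⟨γ, h1, h2⟩ | ⟨γ, h1, h2⟩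
  · rcases γ with _ | ⟨c, γ⟩
    · rw [List.append_nil] at h1
      rw [← h1]
      simpa [List.count_replicate] using hB.count_z_le i
    · rw [List.cons_append, List.cons.injEq] at h2
      have h3 : t i ∈ x :: (B ++ List.replicate (n + 1) x) := by rw [h1, h2.1]; simp
      have h4 : t i ∈ B := by simpa using h3
      rw [hB.mem_iff] at h4
      exact absurd h4 (t_notMem_body i)
  · have h3 : z i ∉ γ := by
      intro h3
      have h4 : [z i, t i] <+ T := h2 ▸ pair_sublist h3 (by simp)
      have h5 := sublist_destutter h4 (by simp)
      rw [hT] at h5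
      have h6 := (pairwise_ending (K := K) i).sublist h5
      simp at h6
    have := hB.count_z_le i
    rw [h1]
    simpa [List.count_replicate, List.count_eq_zero.2 h3] using this

/-- A prefix without z_{π(k)} stops inside x B, before the second island of x. -/
theorem LambdaList.split_of_notMem {α β : List Letter} (h : LambdaList (α ++ β) (wordA K σ))
    (hα : z (σ (K + 1)) ∉ α) : α.count x ≤ 1 ∧ x ∈ β := by
  obtain ⟨B, n, T, hu, hB, hT⟩ := h.exists_of_wordA
  have hu' : α ++ β = (x :: B) ++ (List.replicate (n + 1) x ++ T) := by simpa using hu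
  have hx : (x :: B).count x = 1 := by simp [List.count_eq_zero.2 hB.x_notMem]
  rcases List.append_eq_append_iff.1 hu' with ⟨γ, h1, h2⟩ | ⟨γ, h1, h2⟩
  · refine ⟨?_, by rw [h2]; simp⟩
    rw [h1, List.count_append] at hx
    omega
  · refine absurd ?_ hα
    rw [h1]
    have := List.mem_of_getLast? hB.getLast?
    simp [this]

variable {X : Letter} {A C : ℕ} {u S R : List Letter}

theorem count_le_of_proj_first (h : LambdaList (u.flatMap (proj K σ X A C)) (wordA K σ))
    {α β : List Letter} (hu : u = α ++ t A :: β) : α.count (z A) ≤ 1 := by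
  have h1 : proj K σ X A C (t A) = [t (σ 0)] := by simp [proj, relabel_first]
  have h2 : proj K σ X A C (z A) = [z (σ 0)] := by simp [proj, relabel_first]
  rw [hu, List.flatMap_append, List.flatMap_cons, h1] at h
  have h3 := mul_count_le_count_flatMap α (proj K σ X A C) (z A) (z (σ 0))
  rw [h2, List.count_singleton_self, mul_one] at h3
  exact h3.trans h.count_z_le_of_t

theorem count_le_of_proj_last (hAC : A ≠ C)
    (h : LambdaList (u.flatMap (proj K σ X A C)) (wordA K σ))
    {α β : List Letter} (hu : u = α ++ t C :: β) : α.count (z C) ≤ 1 := by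
  have h1 : proj K σ X A C (t C) = [t (σ (K + 1))] := by simp [proj, relabel_last hAC]
  have h2 : proj K σ X A C (z C) = [z (σ (K + 1))] := by simp [proj, relabel_last hAC]
  rw [hu, List.flatMap_append, List.flatMap_cons, h1] at h
  have h3 := mul_count_le_count_flatMap α (proj K σ X A C) (z C) (z (σ (K + 1)))
  rw [h2, List.count_singleton_self, mul_one] at h3
  exact h3.trans h.count_z_le_of_t

/-- `t b` is sent to the letter t₁, which is simple and ends the target; an image of `z a` cannot
follow it. -/
theorem notMem_of_mark {a b : ℕ} (hab : a ≠ b)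
    (hS : IsInnerFactor (z 0 :: (S ++ [t 0, z 0, t 1])) (wordA K σ))
    (h : LambdaList (u.flatMap (mark a b S)) (z 0 :: (S ++ [t 0, z 0, t 1])))
    {α β : List Letter} (hu : u = α ++ t b :: β) : z a ∉ β := by
  intro hz
  have h1 : [t 1, z 0] <+ u.flatMap (mark a b S) := by
    rw [hu, List.append_cons, List.flatMap_append]
    refine pair_sublist ?_ (List.mem_flatMap.2 ⟨_, hz, by simp [mark]⟩)
    exact List.mem_flatMap.2 ⟨t b, by simp, by simp [mark, hab.symm]⟩
  have h2 := h.sublist h1 (by simp)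
  have h3 : z 0 :: (S ++ [t 0, z 0, t 1]) = (z 0 :: (S ++ [t 0, z 0])) ++ [t 1] := by simp
  obtain ⟨f₁, f₂, -, hf⟩ := hS
  have h4 := count_t_wordA_le (K := K) (σ := σ) 1
  rw [hf, h3, List.count_append, List.count_append, List.count_append,
    List.count_singleton_self] at h4
  rw [h3] at h2
  have h5 := (sublist_right_of_notMem h2 (List.count_eq_zero.1 (by omega))).length_le
  simp at h5

theorem InThird.notMem (hR : y K ∉ R) (h : InThird K σ R u) {α β : List Letter}
    (hu : u = α ++ z (K + 3) :: β) : x ∉ β := by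
  intro hx
  have h1 : [z (σ (K + 1)), y K] <+ u.flatMap (probe K σ R) := by
    rw [hu, List.append_cons, List.flatMap_append]
    refine pair_sublist ?_ (List.mem_flatMap.2 ⟨_, hx, by simp [probe]⟩)
    exact List.mem_flatMap.2 ⟨z (K + 3), by simp, by simp [probe]⟩
  have h2 := sublist_right_of_notMem (h.sublist h1 (by simp)) (by simp)
  have h3 : y K ∈ z (σ (K + 1)) :: (R ++ [z (σ (K + 1))]) := h2.subset (by simp)
  simp [hR] at h3

/-- A block that occurs twice cannot contain both `a` and `d`, if `d` occurs at most once before,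
and `a` does not occur after, each letter `c`. -/
theorem notMem_of_occurs_twice {v u₁ u₂ u₃ : List Letter} {a d c : Letter}
    (hu : u = u₁ ++ v ++ u₂ ++ v ++ u₃) (hc : c ∈ u)
    (h1 : ∀ α β, u = α ++ c :: β → α.count d ≤ 1) (h2 : ∀ α β, u = α ++ c :: β → a ∉ β)
    (hd : d ∈ v) : a ∉ v := by
  intro ha
  by_cases h3 : c ∈ u₁ ++ v ++ u₂
  · obtain ⟨α, β, h4⟩ := List.append_of_mem h3
    exact h2 α (β ++ v ++ u₃) (by rw [hu, h4]; simp) (by simp [ha])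
  · have h4 : c ∈ u₃ := by
      rw [hu] at hc
      simp only [List.mem_append] at hc h3
      tauto
    obtain ⟨α, β, h5⟩ := List.append_of_mem h4
    have h6 := h1 (u₁ ++ v ++ u₂ ++ v ++ α) β (by rw [hu, h5]; simp)
    have h7 := List.count_pos_iff.2 hd
    simp only [List.count_append] at h6
    omega

theorem exists_flatMap_eq_of_two_le_count {U p q : List Letter} {φ : Letter → List Letter}
    {l : Letter} (h : 2 ≤ U.count l) :
    ∃ u₁ u₂ u₃, p ++ U.flatMap φ ++ q = u₁ ++ φ l ++ u₂ ++ φ l ++ u₃ := by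
  obtain ⟨U₁, V, rfl, hU₁⟩ := List.eq_append_cons_of_mem
    (List.count_pos_iff.1 (by omega : 0 < U.count l))
  rw [List.count_append, List.count_eq_zero.2 hU₁, List.count_cons_self] at h
  obtain ⟨U₂, U₃, rfl⟩ := List.append_of_mem (List.count_pos_iff.1 (by omega : 0 < V.count l))
  exact ⟨p ++ U₁.flatMap φ, U₂.flatMap φ, U₃.flatMap φ ++ q, by simp⟩

theorem t_mem_wordA {i : ℕ} (hi : i < K + 2) : t i ∈ wordA K σ := by
  simp [wordA, ending, hi]

variable {U p q : List Letter} {φ : Letter → List Letter} {l : Letter}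

/-- The separating letter is `t (K + 2)`: by `mark` no z_{π(1)} follows it, and by the second
projection at most one z' precedes it. -/
theorem InFirst.notMem (hσ : ∀ i, σ i < K + 2 ↔ i < K + 2)
    (hS : IsInnerFactor (z 0 :: (S ++ [t 0, z 0, t 1])) (wordA K σ))
    (h : InFirst K σ S (p ++ U.flatMap φ ++ q)) (hl : 2 ≤ U.count l) (hd : z (K + 2) ∈ φ l) :
    z (σ 0) ∉ φ l := by
  have h0 := (hσ 0).2 (by omega)
  obtain ⟨u₁, u₂, u₃, hu⟩ := exists_flatMap_eq_of_two_le_count (p := p) (q := q) (φ := φ) hl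
  exact notMem_of_occurs_twice hu (t_first_of_mem ((h.proj_double.mem_iff _).2 (t_mem_wordA h0)))
    (fun α β => count_le_of_proj_first h.proj_double)
    (fun α β => notMem_of_mark (by omega) hS h.mark) hd

theorem InSecond.notMem (hσ : ∀ i, σ i < K + 2 ↔ i < K + 2)
    (hS : IsInnerFactor (z 0 :: (S ++ [t 0, z 0, t 1])) (wordA K σ))
    (h : InSecond K σ S (p ++ U.flatMap φ ++ q)) (hl : 2 ≤ U.count l) (hd : z (K + 3) ∈ φ l) :
    z (σ (K + 1)) ∉ φ l := by
  have h0 := (hσ (K + 1)).2 (by omega)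
  obtain ⟨u₁, u₂, u₃, hu⟩ := exists_flatMap_eq_of_two_le_count (p := p) (q := q) (φ := φ) hl
  exact notMem_of_occurs_twice hu (t_last_of_mem ((h.proj_double.mem_iff _).2 (t_mem_wordA h0)))
    (fun α β => count_le_of_proj_last (by omega) h.proj_double)
    (fun α β => notMem_of_mark (by omega) hS h.mark) hd

end Order

/-! ### Stability of the three sets. -/

section Stable

variable {K : ℕ} {σ : Equiv.Perm ℕ} {S R p q s : List Letter} {φ : Letter → List Letter}
  {X : Letter} {A C A' C' : ℕ}

theorem wordA_eq_append : wordA K σ = [] ++ wordA K σ ++ [] := by simp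

/-- The outer letter and y₀ survive in every projection with the same `X`, and a harmless insertion
would identify their images. Hence the main case in one projection forces it in the other. -/
theorem RightMain.not_harmless {V : List Letter} (hX : X = x ∨ X = y (K + 2))
    (hm : RightMain K σ (proj K σ X A C) φ p) :
    ¬ Harmless (fun l => (φ l).flatMap (proj K σ X A' C')) (y (K + 2)) (innerPart K σ) V := by
  intro hg
  have h1 : x ∈ (φ (y (K + 2))).flatMap (proj K σ X A C) := by rw [hm.apply_eq]; simp
  have h2 := hm.y_mem
  rw [x_mem_flatMap_proj hX] at h1
  rw [y_zero_mem_flatMap_proj] at h2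
  have := hg.eq (a := x) (b := y 0) ((x_mem_flatMap_proj hX).2 h1) (by
    rw [← List.flatMap_assoc]; exact y_zero_mem_flatMap_proj.2 h2)
  simp at this

theorem LeftMain.not_harmless {V : List Letter} (hX : X = x ∨ X = y (K + 2))
    (hm : LeftMain K σ (proj K σ X A C) φ s) :
    ¬ Harmless (fun l => (φ l).flatMap (proj K σ X A' C')) x
      (z (σ 0) :: y (K + 2) :: (innerPart K σ ++ s)) V := by
  intro hg
  have h1 : x ∈ (φ x).flatMap (proj K σ X A C) := by rw [hm.apply_eq]; simp
  have h2 := hm.y_mem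
  rw [x_mem_flatMap_proj hX] at h1
  rw [y_zero_mem_flatMap_proj] at h2
  have := hg.eq (a := x) (b := y 0) ((x_mem_flatMap_proj hX).2 h1) (by
    rw [← List.flatMap_assoc]; exact y_zero_mem_flatMap_proj.2 h2)
  simp at this

theorem LeftMain.x_notMem (hX : X = x ∨ X = y (K + 2)) (hm : LeftMain K σ (proj K σ X A C) φ s) :
    x ∉ (φ (y (K + 2))).flatMap (proj K σ X A' C') := by
  rw [x_mem_flatMap_proj hX, ← x_mem_flatMap_proj (σ := σ) (A := A) (C := C) hX, hm.apply_y]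
  simp

theorem inFirst_right_iff (hσ : ∀ i, σ i < K + 2 ↔ i < K + 2) (hs : ∀ a ∈ s, a = x)
    (hS : IsInnerFactor (z 0 :: (S ++ [t 0, z 0, t 1])) (wordA K σ)) :
    InFirst K σ S (inst K σ φ p q s) ↔ InFirst K σ S (inst K σ φ p q (y (K + 2) :: s)) := by
  constructor
  swap
  · exact fun h => ⟨right_delete hσ hs wordA_eq_append h.proj_first,
      right_delete hσ hs wordA_eq_append h.proj_double, (right_iff hσ hs hS).2 h.mark⟩
  intro h
  have h1 := harmless_or_rightMain hσ hs h.proj_first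
  have h2 := harmless_or_rightMain hσ hs h.proj_double
  -- If both projections were main, the block substituted for z' would contain both z_{π(1)} and z',
  -- although it occurs twice.
  have h3 : ∀ {A C A' C' : ℕ}, A = σ 0 → A' = K + 2 →
      RightMain K σ (proj K σ x A C) φ p → RightMain K σ (proj K σ x A' C') φ p → False := by
    rintro A C A' C' rfl rfl hm hm'
    exact h.notMem hσ hS (two_le_count_doubledWord hσ (fun a ha => Or.inl (hs a ha))
      (by simp [innerPart])) (z_first_of_mem hm'.first_mem) (z_first_of_mem hm.first_mem)
  refine ⟨?_, ?_, (right_iff hσ hs hS).1 h.mark⟩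
  · refine right_insert (h1.resolve_right fun hm => ?_) h.proj_first
    exact h3 rfl rfl hm (h2.resolve_left (hm.not_harmless (Or.inl rfl)))
  · refine right_insert (h2.resolve_right fun hm => ?_) h.proj_double
    exact h3 rfl rfl (h1.resolve_left (hm.not_harmless (Or.inl rfl))) hm

theorem inSecond_left_iff (hσ : ∀ i, σ i < K + 2 ↔ i < K + 2) (hs : ∀ a ∈ s, a = y (K + 2))
    (hS : IsInnerFactor (z 0 :: (S ++ [t 0, z 0, t 1])) (wordA K σ)) :
    InSecond K σ S (inst K σ φ p q s) ↔ InSecond K σ S (inst K σ φ p q (s ++ [x])) := by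
  constructor
  swap
  · exact fun h => ⟨left_delete hσ hs wordA_eq_append h.proj_last,
      left_delete hσ hs wordA_eq_append h.proj_double, (left_iff hσ hs hS).2 h.mark⟩
  intro h
  have h1 := harmless_or_leftMain hσ hs h.proj_last
  have h2 := harmless_or_leftMain hσ hs h.proj_double
  have h3 : ∀ {A C A' C' : ℕ}, C = σ (K + 1) → C' = K + 3 →
      LeftMain K σ (proj K σ (y (K + 2)) A C) φ s →
      LeftMain K σ (proj K σ (y (K + 2)) A' C') φ s → False := by
    rintro A C A' C' rfl rfl hm hm'
    exact h.notMem hσ hS (two_le_count_doubledWord hσ (fun a ha => Or.inr (hs a ha))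
      (by simp)) (z_last_of_mem hm'.last_mem) (z_last_of_mem hm.last_mem)
  refine ⟨?_, ?_, (left_iff hσ hs hS).1 h.mark⟩
  · rcases h1 with h1 | h1 | hm
    · exact left_insert h1 h.proj_last
    · exact left_insert_of_eq_x h1.1 h1.2.2 h.proj_last
    · exact (h3 rfl rfl hm ((h2.resolve_left (hm.not_harmless (Or.inr rfl))).resolve_left
        fun h4 => hm.x_notMem (Or.inr rfl) h4.2.1)).elim
  · rcases h2 with h2 | h2 | hm
    · exact left_insert h2 h.proj_double
    · exact left_insert_of_eq_x h2.1 h2.2.2 h.proj_double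
    · exact (h3 rfl rfl ((h1.resolve_left (hm.not_harmless (Or.inr rfl))).resolve_left
        fun h4 => hm.x_notMem (Or.inr rfl) h4.2.1) hm).elim

/-- In a word from all three sets, the letter `x'` cannot be in the place of `x` in both
projections with `x'`. -/
theorem not_rightMain_and_rightMain (hσ : ∀ i, σ i < K + 2 ↔ i < K + 2) (hR : y K ∉ R)
    (h1 : LambdaList ((inst K σ φ p q [x]).flatMap (proj K σ x A (σ (K + 1)))) (wordA K σ))
    (h3 : InThird K σ R (inst K σ φ p q [x]))
    (hm : RightMain K σ (proj K σ (y (K + 2)) (K + 2) (σ (K + 1))) φ p)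
    (hm' : RightMain K σ (proj K σ (y (K + 2)) A' (K + 3)) φ p) : False := by
  have hk := (hσ (K + 1)).2 (by omega)
  -- The cut is made before the image of z_{π(k)}. Because of the inserted x, u₁ contains two copies
  -- of φ(x).
  set u₁ := p ++ φ x ++ φ (z (σ 0)) ++ φ (y (K + 2)) ++ (innerPart K σ).flatMap φ ++ φ x with hu₁
  set v := φ (z (σ (K + 1))) ++ φ x ++ φ (z (K + 3)) with hv
  set u₃ := φ (y (K + 2)) ++ (doubledEnding K σ).flatMap φ ++ q with hu₃
  have hu : inst K σ φ p q [x] = u₁ ++ v ++ u₃ := by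
    simp [inst, doubledWord, hu₁, hv, hu₃]
  have hne : K + 2 ≠ σ (K + 1) := by omega
  have key : ∀ {w : List Letter}, z (σ (K + 1)) ∉ w.flatMap (proj K σ (y (K + 2)) (K + 2) (σ (K + 1))) →
      z (σ (K + 1)) ∉ w := by
    intro w h h'
    exact h (List.mem_flatMap.2 ⟨_, h', by simp [proj, relabel_last hne]⟩)
  have hz : z (σ (K + 1)) ∉ u₁ := by
    rw [hu₁]
    simp only [List.mem_append, not_or]
    exact ⟨⟨⟨⟨⟨key (by simp [hm.left_eq]), key (by simp [hm.apply_x])⟩,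
      key (by simp [hm.apply_first])⟩, key (by simp [hm.apply_eq])⟩, key hm.last_notMem⟩,
      key (by simp [hm.apply_x])⟩
  have hc : z (K + 3) ∈ v := by
    have := z_last_of_mem hm'.last_mem
    simp only [List.mem_append] at this
    simp only [hv, List.mem_append]
    tauto
  -- v contains z'', and no x follows z'' in a word of Q₃.
  have hx3 : x ∉ u₃ := by
    obtain ⟨v₁, v₂, hv'⟩ := List.append_of_mem hc
    have := h3.notMem hR (α := u₁ ++ v₁) (β := v₂ ++ u₃) (by rw [hu, hv']; simp)
    rw [List.mem_append, not_or] at this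
    exact this.2
  have h4 : LambdaList (u₁.flatMap (proj K σ x A (σ (K + 1))) ++
      (v ++ u₃).flatMap (proj K σ x A (σ (K + 1)))) (wordA K σ) := by
    rw [← List.flatMap_append, ← List.append_assoc, ← hu]; exact h1
  obtain ⟨h5, h6⟩ := h4.split_of_notMem fun h => hz (z_last_of_mem h)
  rw [x_mem_flatMap_proj (Or.inl rfl), List.mem_append] at h6
  have h7 := mul_count_le_count_flatMap u₁ (proj K σ x A (σ (K + 1))) x x
  have h8 : (proj K σ x A (σ (K + 1)) x).count x = 1 := by simp [proj]
  rw [h8, mul_one] at h7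
  -- u₁ has no z_{π(k)}, hence at most one x, but it contains φ(x) twice.
  have h9 : x ∉ φ x := by
    intro h
    have := List.count_pos_iff.2 h
    have h10 : u₁.count x ≥ (φ x).count x + (φ x).count x := by
      simp only [hu₁, List.count_append]; omega
    omega
  -- The letters z of v recur in the ending, so their images are factors of u₃. Thus x is absent
  -- from v and from u₃, although an x must occur after u₁.
  have hsub : ∀ {i}, z i ∈ doubledEnding K σ → x ∉ φ (z i) := by
    intro i hi h
    refine hx3 ?_
    have := List.mem_flatMap.2 ⟨_, hi, h⟩
    simp [hu₃, this]
  have h11 := hsub (z_mem_doubledEnding (σ := σ) hk)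
  have h12 := hsub (z_mem_doubledEnding_last hk)
  simp only [hv, List.mem_append] at h6
  tauto

theorem inSecond_right_iff (hσ : ∀ i, σ i < K + 2 ↔ i < K + 2)
    (hS : IsInnerFactor (z 0 :: (S ++ [t 0, z 0, t 1])) (wordA K σ)) (hR : y K ∉ R)
    (h1 : InFirst K σ S (inst K σ φ p q [x])) (h3 : InThird K σ R (inst K σ φ p q [x])) :
    InSecond K σ S (inst K σ φ p q [x]) ↔ InSecond K σ S (inst K σ φ p q [y (K + 2), x]) := by
  have hs : ∀ a ∈ [x], a = x := by simp
  constructor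
  swap
  · exact fun h => ⟨right_delete hσ hs wordA_eq_append h.proj_last,
      right_delete hσ hs wordA_eq_append h.proj_double, (right_iff hσ hs hS).2 h.mark⟩
  intro h
  have h4 := harmless_or_rightMain hσ hs h.proj_last
  have h5 := harmless_or_rightMain hσ hs h.proj_double
  refine ⟨?_, ?_, (right_iff hσ hs hS).1 h.mark⟩
  · refine right_insert (h4.resolve_right fun hm => ?_) h.proj_last
    exact not_rightMain_and_rightMain hσ hR h1.proj_first h3 hm
      (h5.resolve_left (hm.not_harmless (Or.inr rfl)))
  · refine right_insert (h5.resolve_right fun hm => ?_) h.proj_double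
    exact not_rightMain_and_rightMain hσ hR h1.proj_first h3
      (h4.resolve_left (hm.not_harmless (Or.inr rfl))) hm

end Stable

/-! ### The lattice of subvarieties -/

/-! ### The factors of a used for marking and probing. -/

section Factors

variable {K : ℕ} {σ : Equiv.Perm ℕ}

/-- The factor runs from z₀ in the body to t₁, which exists because k ≥ 2. It starts after the first
x, so it is inner. -/
theorem exists_isInnerFactor_mark (hσ : ∀ i, σ i < K + 2 ↔ i < K + 2) :
    ∃ S, IsInnerFactor (z 0 :: (S ++ [t 0, z 0, t 1])) (wordA K σ) := by
  have h0 : z 0 ∈ body 2 K σ := by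
    obtain ⟨j, hj⟩ := σ.surjective 0
    have h1 : j < K + 2 := (hσ j).1 (by omega)
    rcases j with _ | j
    · simp [body, hj]
    · by_cases h2 : j = K
      · simp [body, ← hj, h2]
      · have : z 0 ∈ midPart 2 K σ := by
          simp only [midPart, List.mem_append, List.mem_flatMap, List.mem_range]
          exact Or.inr ⟨j, by omega, by simp [hj]⟩
        simp [body, this]
  obtain ⟨B₁, B₂, hB⟩ := List.append_of_mem h0
  obtain ⟨E, hE⟩ : ∃ E, ending K = [t 0, z 0, t 1] ++ E := by
    simp [ending, List.range_succ_eq_map]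
  exact ⟨B₂ ++ [x], x :: B₁, E, by simp, by simp [wordA, hB, hE]⟩

/-- The factor runs from the square of the last y, just before z_{π(k)} in the body, to the
occurrence of z_{π(k)} in the ending. -/
theorem exists_isInnerFactor_probe (hσ : ∀ i, σ i < K + 2 ↔ i < K + 2) :
    ∃ R, y K ∉ R ∧
      IsInnerFactor ([y K, y K] ++ (z (σ (K + 1)) :: (R ++ [z (σ (K + 1))]))) (wordA K σ) := by
  obtain ⟨L₁, L₂, hL⟩ := List.append_of_mem (List.mem_range.2 ((hσ (K + 1)).2 (by omega)))
  obtain ⟨E₁, E₂, hE⟩ : ∃ E₁ E₂, ending K = E₁ ++ [t (σ (K + 1)), z (σ (K + 1))] ++ E₂ := by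
    refine ⟨L₁.flatMap fun i => [t i, z i], L₂.flatMap fun i => [t i, z i], ?_⟩
    rw [ending, hL]
    simp
  obtain ⟨B, hB⟩ : ∃ B, midPart 2 K σ = B ++ [y K, y K] := by
    rcases K with _ | K
    · exact ⟨[], by simp [midPart, List.replicate_succ]⟩
    · refine ⟨List.replicate 2 (y 0) ++ (List.range K).flatMap (fun i => z (σ (i + 1)) ::
        List.replicate 2 (y (i + 1))) ++ [z (σ (K + 1))], ?_⟩
      simp [midPart, List.range_succ, List.replicate_succ]
  refine ⟨x :: (E₁ ++ [t (σ (K + 1))]), fun h => ?_, x :: z (σ 0) :: B, E₂, by simp, ?_⟩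
  · refine y_notMem_ending (K := K) K ?_
    rw [hE]
    simp at h
    simp [h]
  · simp [wordA, body, hB, hE]

/-- The inserted x' is a second one before z_{π(k)}, while a has just one x there. -/
theorem not_inSecond (hσ : ∀ i, σ i < K + 2 ↔ i < K + 2) {S : List Letter} :
    ¬ InSecond K σ S (doubledWord K σ [y (K + 2)]) := by
  intro h
  have hk := (hσ (K + 1)).2 (by omega)
  have e : doubledWord K σ [y (K + 2)] = ([x, z (σ 0), y (K + 2)] ++ innerPart K σ ++
      [y (K + 2)]) ++ z (σ (K + 1)) :: x :: z (K + 3) :: y (K + 2) :: doubledEnding K σ := by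
    simp [doubledWord]
  have h1 := h.proj_last
  rw [e, List.flatMap_append] at h1
  have h2 := (h1.split_of_notMem fun h2 => ?_).1
  · have h3 := (mul_count_le_count_flatMap _ _ (y (K + 2)) x).trans h2
    simp [proj] at h3
  · have h3 := z_last_of_mem h2
    have h4 : σ (K + 1) ≠ K + 2 := by omega
    simp [innerPart, midPart, h4] at h3

end Factors

/-! ### Failure of distributivity. -/

section Varieties

variable {K : ℕ} {σ : Equiv.Perm ℕ} {u v : Word}

theorem toList_mul_lift_mul (φ : Letter → Word) (p q : Word) (s : List Letter) :
    (p * FreeMonoid.lift φ (FreeMonoid.ofList (doubledWord K σ s)) * q).toList =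
      inst K σ (fun a => (φ a).toList) p.toList q.toList s := by
  simp only [inst, FreeMonoid.toList_mul, toList_lift, FreeMonoid.toList_ofList]

theorem stableUnder_of_inst {P : List Letter → Prop} {s s' : List Letter}
    (h : ∀ φ p q, P (inst K σ φ p q s) ↔ P (inst K σ φ p q s')) :
    StableUnder {u : Word | P u.toList} (FreeMonoid.ofList (doubledWord K σ s))
      (FreeMonoid.ofList (doubledWord K σ s')) := by
  intro φ p q
  simp only [Set.mem_ofPred_eq, toList_mul_lift_mul]
  exact h _ _ _

theorem stableUnder_lambdaList {f : List Letter} (hf : ∃ f₁ f₂, wordA K σ = f₁ ++ f ++ f₂)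
    (h : Letter → List Letter)
    (huv : SatisfiesIdentity (SapirMonoid lambdaCon
      {((FreeMonoid.ofList (wordA K σ) : Word) : lambdaCon.Quotient)}) u v) :
    StableUnder {u : Word | LambdaList (u.toList.flatMap h) f} u v := by
  obtain ⟨f₁, f₂, hf⟩ := hf
  have h1 := stableUnder_imageClass (w := FreeMonoid.ofList (wordA K σ)) (f := FreeMonoid.ofList f)
    (f₁ := FreeMonoid.ofList f₁) (f₂ := FreeMonoid.ofList f₂)
    (by rw [hf, FreeMonoid.ofList_append, FreeMonoid.ofList_append])
    (fun l => FreeMonoid.ofList (h l)) huv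
  have h2 : imageClass (fun l => FreeMonoid.ofList (h l)) (FreeMonoid.ofList f) =
      {u : Word | LambdaList (u.toList.flatMap h) f} := by
    ext w
    have : FreeMonoid.lift (fun l => FreeMonoid.ofList (h l)) w =
        FreeMonoid.ofList (w.toList.flatMap h) := by
      apply FreeMonoid.toList.injective
      rw [toList_lift]; simp
    simp [imageClass, LambdaList, this]
  rwa [h2] at h1

variable {S R : List Letter}

theorem stableUnder_inFirst (hS : IsInnerFactor (z 0 :: (S ++ [t 0, z 0, t 1])) (wordA K σ))
    (huv : SatisfiesIdentity (SapirMonoid lambdaCon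
      {((FreeMonoid.ofList (wordA K σ) : Word) : lambdaCon.Quotient)}) u v) :
    StableUnder {u : Word | InFirst K σ S u.toList} u v := by
  obtain ⟨f₁, f₂, -, hS⟩ := hS
  have hw : ∃ f₁ f₂, wordA K σ = f₁ ++ wordA K σ ++ f₂ := ⟨_, _, wordA_eq_append⟩
  intro φ p q
  have h1 := stableUnder_lambdaList hw (proj K σ x (σ 0) (σ (K + 1))) huv φ p q
  have h2 := stableUnder_lambdaList hw (proj K σ x (K + 2) (σ (K + 1))) huv φ p q
  have h3 := stableUnder_lambdaList ⟨f₁, f₂, hS⟩ (mark (σ 0) (K + 2) S) huv φ p q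
  exact ⟨fun h => ⟨h1.1 h.1, h2.1 h.2, h3.1 h.3⟩, fun h => ⟨h1.2 h.1, h2.2 h.2, h3.2 h.3⟩⟩

theorem stableUnder_inSecond (hS : IsInnerFactor (z 0 :: (S ++ [t 0, z 0, t 1])) (wordA K σ))
    (huv : SatisfiesIdentity (SapirMonoid lambdaCon
      {((FreeMonoid.ofList (wordA K σ) : Word) : lambdaCon.Quotient)}) u v) :
    StableUnder {u : Word | InSecond K σ S u.toList} u v := by
  obtain ⟨f₁, f₂, -, hS⟩ := hS
  have hw : ∃ f₁ f₂, wordA K σ = f₁ ++ wordA K σ ++ f₂ := ⟨_, _, wordA_eq_append⟩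
  intro φ p q
  have h1 := stableUnder_lambdaList hw (proj K σ (y (K + 2)) (K + 2) (σ (K + 1))) huv φ p q
  have h2 := stableUnder_lambdaList hw (proj K σ (y (K + 2)) (K + 2) (K + 3)) huv φ p q
  have h3 := stableUnder_lambdaList ⟨f₁, f₂, hS⟩ (mark (σ (K + 1)) (K + 3) S) huv φ p q
  exact ⟨fun h => ⟨h1.1 h.1, h2.1 h.2, h3.1 h.3⟩, fun h => ⟨h1.2 h.1, h2.2 h.2, h3.2 h.3⟩⟩

theorem stableUnder_inThird
    (hR : IsInnerFactor ([y K, y K] ++ (z (σ (K + 1)) :: (R ++ [z (σ (K + 1))]))) (wordA K σ))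
    (huv : SatisfiesIdentity (SapirMonoid lambdaCon
      {((FreeMonoid.ofList (wordA K σ) : Word) : lambdaCon.Quotient)}) u v) :
    StableUnder {u : Word | InThird K σ R u.toList} u v := by
  obtain ⟨f₁, f₂, -, hR⟩ := hR
  exact stableUnder_lambdaList ⟨f₁, f₂, hR⟩ (probe K σ R) huv

open MonoidVariety in
theorem not_isDistributive_sapirVariety (hσ : ∀ i, σ i < K + 2 ↔ i < K + 2) :
    ¬ (sapirVariety lambdaCon
      {((FreeMonoid.ofList (wordA K σ) : Word) : lambdaCon.Quotient)}).IsDistributive := by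
  intro hV
  obtain ⟨S, hS⟩ := exists_isInnerFactor_mark hσ
  obtain ⟨R, hRy, hR⟩ := exists_isInnerFactor_probe hσ
  have hσ' : ∀ i < K + 2, σ i < K + 2 := fun i => (hσ i).2
  set V := sapirVariety lambdaCon {((FreeMonoid.ofList (wordA K σ) : Word) : lambdaCon.Quotient)}
  let Q₁ : Set Word := {u | InFirst K σ S u.toList}
  let Q₂ : Set Word := {u | InSecond K σ S u.toList}
  let Q₃ : Set Word := {u | InThird K σ R u.toList}
  let D : List Letter → Word := fun s => FreeMonoid.ofList (doubledWord K σ s)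
  have hQ₁ : ∀ {s}, (∀ a ∈ s, a = x) → StableUnder Q₁ (D s) (D (y (K + 2) :: s)) := fun hs =>
    stableUnder_of_inst fun φ p q => inFirst_right_iff hσ hs hS
  have hQ₂ : ∀ {s}, (∀ a ∈ s, a = y (K + 2)) → StableUnder Q₂ (D s) (D (s ++ [x])) := fun hs =>
    stableUnder_of_inst fun φ p q => inSecond_left_iff hσ hs hS
  have hQ₃ : ∀ {s}, (∀ a ∈ s, a = x) → StableUnder Q₃ (D s) (D (y (K + 2) :: s)) := fun hs =>
    stableUnder_of_inst fun φ p q => right_iff hσ hs hR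
  have hQ₃' : ∀ {s}, (∀ a ∈ s, a = y (K + 2)) → StableUnder Q₃ (D s) (D (s ++ [x])) := fun hs =>
    stableUnder_of_inst fun φ p q => left_iff hσ hs hR
  -- Q₁ and Q₃ are stable on their own; Q₂ is compared only for words whose instance of D[x] already
  -- lies in Q₁ and Q₃.
  have hQ : StableUnder ((Q₁ ∩ Q₃) ∩ (Q₂ ∩ Q₃)) (D [x]) (D [y (K + 2), x]) := by
    intro φ p q
    have h1 := hQ₁ (s := [x]) (by simp) φ p q
    have h3 := hQ₃ (s := [x]) (by simp) φ p q
    have h2 : p * FreeMonoid.lift φ (D [x]) * q ∈ Q₁ → p * FreeMonoid.lift φ (D [x]) * q ∈ Q₃ →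
        (p * FreeMonoid.lift φ (D [x]) * q ∈ Q₂ ↔
          p * FreeMonoid.lift φ (D [y (K + 2), x]) * q ∈ Q₂) := by
      simp only [Q₁, Q₂, Q₃, D, Set.mem_ofPred_eq, toList_mul_lift_mul]
      exact inSecond_right_iff hσ hS hRy
    simp only [Set.mem_inter_iff]
    tauto
  have hle : ∀ {Q : Set Word} {E : Set (Word × Word)}, (∀ e ∈ E, StableUnder Q e.1 e.2) ↔
      generatedBy (syntacticCon Q).Quotient ≤ ofIdentities E := by
    intro Q E
    rw [generatedBy_le_ofIdentities]
    simp only [satisfiesIdentity_syntacticCon]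
  have hQV : ∀ {Q : Set Word}, (∀ u v, SatisfiesIdentity (SapirMonoid lambdaCon
      {((FreeMonoid.ofList (wordA K σ) : Word) : lambdaCon.Quotient)}) u v → StableUnder Q u v) →
      generatedBy (syntacticCon Q).Quotient ≤ V := fun h =>
    le_of_forall_identities fun u v huv => satisfiesIdentity_syntacticCon.2
      (h u v (generatedBy_le_ofIdentities.1 huv (u, v) rfl))
  have h₁₃ : generatedBy (syntacticCon (Q₁ ∩ Q₃)).Quotient ≤
      V ⊓ ofIdentities {(D [], D [y (K + 2)])} :=
    le_inf (hQV fun u v h => (stableUnder_inFirst hS h).inter (stableUnder_inThird hR h))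
      (hle.1 (by rintro _ rfl; exact (hQ₁ (by simp)).inter (hQ₃ (by simp))))
  have h₂₃ : generatedBy (syntacticCon (Q₂ ∩ Q₃)).Quotient ≤
      V ⊓ ofIdentities {(D [], D [x]), (D [y (K + 2)], D [y (K + 2), x])} :=
    le_inf (hQV fun u v h => (stableUnder_inSecond hS h).inter (stableUnder_inThird hR h))
      (hle.1 (by
        rintro _ (rfl | rfl)
        · exact (hQ₂ (s := []) (by simp)).inter (hQ₃' (s := []) (by simp))
        · exact (hQ₂ (s := [y (K + 2)]) (by simp)).inter (hQ₃' (s := [y (K + 2)]) (by simp))))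
  have hN : generatedBy (syntacticCon ((Q₁ ∩ Q₃) ∩ (Q₂ ∩ Q₃))).Quotient ≤
      ofIdentities {(D [], D [y (K + 2)])} := by
    refine hV.le (Z := ofIdentities {(D [x], D [y (K + 2), x])})
      (hQV fun u v h => ((stableUnder_inFirst hS h).inter (stableUnder_inThird hR h)).inter
        ((stableUnder_inSecond hS h).inter (stableUnder_inThird hR h)))
      (le_of_forall_identities fun u v h => satisfiesIdentity_syntacticCon.2 ?_)
      (hle.1 (by rintro _ rfl; exact hQ)) le_rfl
      (Y := ofIdentities {(D [], D [x]), (D [y (K + 2)], D [y (K + 2), x])}) ?_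
    -- An identity of the join holds in both syntactic monoids, so both sets, and hence their
    -- intersection, are stable under it.
    · have h1 := hle.2 (h₁₃.trans (le_sup_left.trans h)) (u, v) rfl
      have h2 := hle.2 (h₂₃.trans (le_sup_right.trans h)) (u, v) rfl
      exact h1.inter h2
    · intro M hM e he
      obtain rfl : e = _ := he
      have h1 := (inf_le_left : ofIdentities {(D [], D [x]), (D [y (K + 2)], D [y (K + 2), x])} ⊓
        ofIdentities {(D [x], D [y (K + 2), x])} ≤ _) hM
      have h2 := (inf_le_right : ofIdentities {(D [], D [x]),
        (D [y (K + 2)], D [y (K + 2), x])} ⊓ ofIdentities {(D [x], D [y (K + 2), x])} ≤ _) hM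
      -- The chain D[1] ≈ D[x] ≈ D[x'x] ≈ D[x'].
      exact fun φ => (h1 _ (Or.inl rfl) φ).trans ((h2 _ rfl φ).trans (h1 _ (Or.inr rfl) φ).symm)
  -- With the identity substitution and empty context, stability would carry D[1] ∈ Q to D[x'] ∈ Q.
  have hst := hle.2 hN _ rfl FreeMonoid.of 1 1
  have hD : ∀ s, (FreeMonoid.lift FreeMonoid.of (D s) : Word) = D s := fun s =>
    DFunLike.congr_fun (FreeMonoid.hom_eq fun _ => FreeMonoid.lift_eval_of _ _ :
      FreeMonoid.lift FreeMonoid.of = MonoidHom.id Word) _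
  simp only [one_mul, mul_one, hD] at hst
  have hw : ∀ {X A C}, (X = x ∧ C = σ (K + 1) ∧ (A = σ 0 ∨ A = K + 2) ∨
      X = y (K + 2) ∧ A = K + 2 ∧ (C = σ (K + 1) ∨ C = K + 3)) →
      LambdaList ((doubledWord K σ []).flatMap (proj K σ X A C)) (wordA K σ) := fun h => by
    rw [flatMap_proj_doubledWord hσ' h]; exact LambdaList.refl _
  have h₁ : InFirst K σ S (doubledWord K σ []) :=
    ⟨hw (by simp), hw (by simp), by
      rw [flatMap_mark_doubledWord_first hσ']; exact LambdaList.refl _⟩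
  have h₂ : InSecond K σ S (doubledWord K σ []) :=
    ⟨hw (by simp), hw (by simp), by
      rw [flatMap_mark_doubledWord_last hσ']; exact LambdaList.refl _⟩
  have h₃ : InThird K σ R (doubledWord K σ []) := by
    rw [InThird, flatMap_probe_doubledWord hσ']; exact LambdaList.refl _
  exact not_inSecond hσ (hst.1 ⟨⟨h₁, h₃⟩, h₂, h₃⟩).2.1

end Varieties

/-! ### From permutations of `Fin k` to permutations of ℕ. -/

theorem exists_extension {k : ℕ} (π : Equiv.Perm (Fin k)) :
    ∃ σ : Equiv.Perm ℕ, (∀ i : Fin k, σ i = π i) ∧ ∀ i, σ i < k ↔ i < k := by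
  have h1 : ∀ i : Fin k, π.extendDomain Fin.equivSubtype (i : ℕ) = π i := fun i =>
    Equiv.Perm.extendDomain_apply_image π Fin.equivSubtype i
  refine ⟨π.extendDomain Fin.equivSubtype, h1, fun i => ?_⟩
  by_cases hi : i < k
  · have := h1 ⟨i, hi⟩
    simp only at this
    simp [this, hi]
  · rw [Equiv.Perm.extendDomain_apply_not_subtype π Fin.equivSubtype hi]

theorem aWord_eq_ofList_wordA {K : ℕ} {π : Equiv.Perm (Fin (K + 2))} {σ : Equiv.Perm ℕ}
    (hσ : ∀ i : Fin (K + 2), σ i = π i) : aWord (K + 2) π = FreeMonoid.ofList (wordA K σ) := by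
  have key : ∀ (F : Fin (K + 2) → Word) (G : ℕ → List Letter), (∀ i, (F i).toList = G i) →
      (List.ofFn F).prod.toList = (List.range (K + 2)).flatMap G := by
    intro F G h
    rw [FreeMonoid.toList_prod, List.map_ofFn, ← List.map_coe_finRange_eq_range, List.flatMap_map,
      List.flatMap_def, List.ofFn_eq_map]
    congr 1
    exact List.map_congr_left fun i _ => h i
  have h1 : (List.range (K + 2)).flatMap (fun i => z (σ i) ::
      if i + 1 < K + 2 then [y i, y i] else []) = body 2 K σ := by
    have h2 : ∀ i ∈ List.range K, (z (σ (i + 1)) ::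
        if i + 1 + 1 < K + 2 then [y (i + 1), y (i + 1)] else []) =
        z (σ (i + 1)) :: List.replicate 2 (y (i + 1)) := by
      intro i hi
      rw [List.mem_range] at hi
      rw [if_pos (by omega)]
      rfl
    -- The first and last indices are split off, since `body` singles out z_{π(1)} and z_{π(k)}; no
    -- y follows the latter.
    rw [List.range_succ, List.range_succ_eq_map, List.flatMap_append, List.flatMap_cons,
      List.flatMap_map]
    simp only [Nat.succ_eq_add_one]
    rw [List.flatMap_congr h2]
    simp [body, midPart, List.replicate_succ]
  apply FreeMonoid.toList.injective
  simp only [aWord, FreeMonoid.toList_mul, FreeMonoid.toList_of, FreeMonoid.toList_ofList]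
  rw [key _ _ fun i => ?_, key _ (fun i => [t i, z i]) fun i => ?_, h1]
  · simp [wordA, ending]
  · simp
  · rw [FreeMonoid.toList_mul, FreeMonoid.toList_of, ← hσ]
    split_ifs <;> simp [pow_two]

theorem mainTheorem4 (k : ℕ) (hk : 2 ≤ k) (π : Equiv.Perm (Fin k)) :
    ¬ (sapirVariety lambdaCon {((aWord k π : Word) : lambdaCon.Quotient)}).IsDistributive := by
  obtain ⟨K, rfl⟩ := Nat.exists_eq_add_of_le' hk
  obtain ⟨σ, h1, h2⟩ := exists_extension π
  rw [aWord_eq_ofList_wordA h1]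
  exact not_isDistributive_sapirVariety h2
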